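/- Let $1\le m\le n$ be integers and let $$G_m=\left\{\begin{pmatrix}A&0\\B&I\end{pmatrix} : A\in \mathrm{GL}_m(\mathbb Z),\ B\in M_{n-m,m}(\mathbb Z)\right\}\le \mathrm{GL}_n(\mathbb Z).$$ Let $M_{ij}$ be the $n\times n$ matrix with entry $1$ in position $(i,j)$ and zeroes elsewhere, let $E_{ij}=I+M_{ij}$ for $i\ne j$, and let $T_1=I-2M_{11}$. Write $[g,h]=ghg^{-1}h^{-1}$. Then $G_m$ has the finite presentation $$\langle\, T_1,\ E_{ij}\ (1\le i\le n,\ 1\le j\le m,\ i\ne j)\ \mid\ R_{1,m}\cup R_{2,m}\cup R_{3,m}\,\rangle ,$$ in which each symbol $T_1$, $E_{ij}$ stands for the matrix of the same name; that is, the assignment of these matrices to the symbols induces an isomorphism from the group so presented onto $G_m$. The sets of relations are as follows. $R_{1,m}$ consists of the commutators $[E_{ij},E_{kl}]$ with $m+1\le i,k\le n$ and $1\le j,l\le m$. $R_{2,m}$ consists of the following words, in which all indices lie in $\{1,\dots,m\}$ and only symbols $E_{ij}$ with $i\neq j$ occur (so that $R_{2,1}=\{T_1^2\}$, and the second and third words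 occur only for $m\ge 2$): - $T_1^2$; - $(E_{12}E_{21}^{-1}E_{12})^4$; - $E_{12}E_{21}^{-1}E_{12}E_{21}E_{12}^{-1}E_{21}$; - $[E_{ij},E_{kl}]$ for $i\ne l$, $j\ne k$; - $[E_{ij},E_{jk}]E_{ik}^{-1}$ for $i,j,k$ distinct; - $[T_1,E_{ij}]$ for $i\ne1$, $j\neq 1$; - $T_1E_{ij}T_1E_{ij}$ for $1\in\{i,j\}$. $R_{3,m}$ consists of the following relations, in which $1\le i,j\le m$, $i\ne j$, and $m+1\le k\le n$, $1\le l\le m$: - $E_{ij}E_{kl}E_{ij}^{-1}=E_{kl}$ for $i\ne l$; - $E_{ij}E_{kl}E_{ij}^{-1}=E_{kj}^{-1}E_{kl}$ for $i=l$; - $T_1E_{kl}T_1=E_{kl}$ for $k,l\ne1$; - $T_1E_{kl}T_1=E_{kl}^{-1}$ for $1\in\{k,l\}$. -/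

import Mathlib

open scoped MatrixGroups commutatorElement

namespace BlockTriangular

/-- The identification of the disjoint union of the first `m` indices and the last `n - m` indices
with the `n` indices, in order. -/
def indexEquiv {n m : ℕ} (hmn : m ≤ n) : Fin m ⊕ Fin (n - m) ≃ Fin n :=
  finSumFinEquiv.trans (finCongr (by omega))

/-- The `n × n` matrix with block form `[[A, 0], [B, I]]`, where `A` is `m × m`, `B` is
`(n - m) × m` and `I` is the identity matrix of size `n - m`. -/
def blockMatrix {n m : ℕ} (hmn : m ≤ n) (A : Matrix (Fin m) (Fin m) ℤ)
    (B : Matrix (Fin (n - m)) (Fin m) ℤ) : Matrix (Fin n) (Fin n) ℤ :=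
  Matrix.reindex (indexEquiv hmn) (indexEquiv hmn) (Matrix.fromBlocks A 0 B 1)

theorem blockMatrix_mul {n m : ℕ} (hmn : m ≤ n) (A A' : Matrix (Fin m) (Fin m) ℤ)
    (B B' : Matrix (Fin (n - m)) (Fin m) ℤ) :
    blockMatrix hmn A B * blockMatrix hmn A' B' = blockMatrix hmn (A * A') (B * A' + B') := by
  simp only [blockMatrix, Matrix.reindex_apply]
  rw [Matrix.submatrix_mul_equiv, Matrix.fromBlocks_multiply]
  simp

theorem blockMatrix_one {n m : ℕ} (hmn : m ≤ n) :
    blockMatrix hmn (1 : Matrix (Fin m) (Fin m) ℤ) 0 = 1 := by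
  simp [blockMatrix, Matrix.fromBlocks_one]

/-- The group `G_m` of the matrices `[[A, 0], [B, I]]` with `A ∈ GL_m(ℤ)` and `B` an arbitrary
integral `(n - m) × m` matrix, as a subgroup of `GL_n(ℤ)`. -/
def blockGroup {n m : ℕ} (hmn : m ≤ n) : Subgroup (GL (Fin n) ℤ) where
  carrier := {g | ∃ (A : GL (Fin m) ℤ) (B : Matrix (Fin (n - m)) (Fin m) ℤ),
    (g : Matrix (Fin n) (Fin n) ℤ) = blockMatrix hmn (A : Matrix (Fin m) (Fin m) ℤ) B}
  mul_mem' := by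
    rintro g h ⟨A, B, hg⟩ ⟨A', B', hh⟩
    refine ⟨A * A', B * (A' : Matrix (Fin m) (Fin m) ℤ) + B', ?_⟩
    rw [Units.val_mul, Units.val_mul, hg, hh, blockMatrix_mul]
  one_mem' := ⟨1, 0, by rw [Units.val_one, Units.val_one, blockMatrix_one]⟩
  inv_mem' := by
    rintro g ⟨A, B, hg⟩
    refine ⟨A⁻¹, -(B * ((A⁻¹ : GL (Fin m) ℤ) : Matrix (Fin m) (Fin m) ℤ)), ?_⟩
    refine Units.inv_eq_of_mul_eq_one_right ?_
    rw [hg, blockMatrix_mul, Units.mul_inv, add_neg_cancel, blockMatrix_one]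

/-- The matrix `E_ij = I + M_ij`, where `M_ij` has entry `1` in position `(i, j)` and zeroes
elsewhere. It is only used for `i ≠ j`. -/
def matE {n : ℕ} (i j : Fin n) : Matrix (Fin n) (Fin n) ℤ := 1 + Matrix.single i j 1

/-- The matrix `T_i = I - 2 M_ii`. -/
def matT {n : ℕ} (i : Fin n) : Matrix (Fin n) (Fin n) ℤ := 1 - 2 • Matrix.single i i 1

/-- The generating symbols: `T` stands for `T_1`, and `E i j` for `E_ij`, with `1 ≤ i ≤ n`,
`1 ≤ j ≤ m` and `i ≠ j`. Indices are numbered from `0`: the value `0` of an index in `Fin n` is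
the index `1` of the usual numbering, and "at most `m`" becomes "of value less than `m`". -/
inductive Gen (n m : ℕ) : Type
  | T : Gen n m
  | E (i j : Fin n) (hj : (j : ℕ) < m) (hij : i ≠ j) : Gen n m

/-- The generator `T_1` of the free group. -/
def wT (n m : ℕ) : FreeGroup (Gen n m) := FreeGroup.of Gen.T

/-- The generator `E_ij` of the free group. -/
def wE {n m : ℕ} (i j : Fin n) (hj : (j : ℕ) < m) (hij : i ≠ j) : FreeGroup (Gen n m) :=
  FreeGroup.of (Gen.E i j hj hij)

/-- `R_{1,m}`: the commutators of the `E_ij` with `m + 1 ≤ i ≤ n` and `1 ≤ j ≤ m`. -/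
inductive R₁ (n m : ℕ) : FreeGroup (Gen n m) → Prop
  | comm (i j k l : Fin n) (hi : m ≤ (i : ℕ)) (hj : (j : ℕ) < m) (hk : m ≤ (k : ℕ))
      (hl : (l : ℕ) < m) (hij : i ≠ j) (hkl : k ≠ l) :
      R₁ n m ⁅wE i j hj hij, wE k l hl hkl⁆

/-- `R_{2,m}`: the relators among `T_1` and the `E_ij` with `1 ≤ i, j ≤ m`. In `braid` and `four`
the indices `p`, `q` are the first and the second index; these two relators occur only when
`2 ≤ m`. For `m = 1` the only relator left is `T_1 ^ 2`. -/
inductive R₂ (n m : ℕ) : FreeGroup (Gen n m) → Prop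
  | T_sq : R₂ n m (wT n m ^ 2)
  | four (p q : Fin n) (hp0 : (p : ℕ) = 0) (hq1 : (q : ℕ) = 1) (hp : (p : ℕ) < m)
      (hq : (q : ℕ) < m) (hpq : p ≠ q) (hqp : q ≠ p) :
      R₂ n m ((wE p q hq hpq * (wE q p hp hqp)⁻¹ * wE p q hq hpq) ^ 4)
  | braid (p q : Fin n) (hp0 : (p : ℕ) = 0) (hq1 : (q : ℕ) = 1) (hp : (p : ℕ) < m)
      (hq : (q : ℕ) < m) (hpq : p ≠ q) (hqp : q ≠ p) :
      R₂ n m (wE p q hq hpq * (wE q p hp hqp)⁻¹ * wE p q hq hpq *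
        wE q p hp hqp * (wE p q hq hpq)⁻¹ * wE q p hp hqp)
  | comm (i j k l : Fin n) (hi : (i : ℕ) < m) (hj : (j : ℕ) < m) (hk : (k : ℕ) < m)
      (hl : (l : ℕ) < m) (hij : i ≠ j) (hkl : k ≠ l) (hil : i ≠ l) (hjk : j ≠ k) :
      R₂ n m ⁅wE i j hj hij, wE k l hl hkl⁆
  | steinberg (i j k : Fin n) (hi : (i : ℕ) < m) (hj : (j : ℕ) < m) (hk : (k : ℕ) < m)
      (hij : i ≠ j) (hjk : j ≠ k) (hik : i ≠ k) :
      R₂ n m (⁅wE i j hj hij, wE j k hk hjk⁆ * (wE i k hk hik)⁻¹)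
  | T_comm (i j : Fin n) (hi : (i : ℕ) < m) (hj : (j : ℕ) < m) (hij : i ≠ j)
      (hi0 : (i : ℕ) ≠ 0) (hj0 : (j : ℕ) ≠ 0) :
      R₂ n m ⁅wT n m, wE i j hj hij⁆
  | T_inv (i j : Fin n) (hi : (i : ℕ) < m) (hj : (j : ℕ) < m) (hij : i ≠ j)
      (h0 : (i : ℕ) = 0 ∨ (j : ℕ) = 0) :
      R₂ n m (wT n m * wE i j hj hij * wT n m * wE i j hj hij)

/-- `R_{3,m}`: the relators `u * v⁻¹` for the relations `u = v` that describe the conjugation of the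
`E_kl` with `m + 1 ≤ k ≤ n`, `1 ≤ l ≤ m` by `T_1` and by the `E_ij` with `1 ≤ i, j ≤ m`. -/
inductive R₃ (n m : ℕ) : FreeGroup (Gen n m) → Prop
  | E_comm (i j k l : Fin n) (hi : (i : ℕ) < m) (hj : (j : ℕ) < m) (hk : m ≤ (k : ℕ))
      (hl : (l : ℕ) < m) (hij : i ≠ j) (hkl : k ≠ l) (hil : i ≠ l) :
      R₃ n m (wE i j hj hij * wE k l hl hkl * (wE i j hj hij)⁻¹ * (wE k l hl hkl)⁻¹)
  | E_act (i j k : Fin n) (hi : (i : ℕ) < m) (hj : (j : ℕ) < m) (hk : m ≤ (k : ℕ))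
      (hij : i ≠ j) (hki : k ≠ i) (hkj : k ≠ j) :
      R₃ n m (wE i j hj hij * wE k i hi hki * (wE i j hj hij)⁻¹ *
        ((wE k j hj hkj)⁻¹ * wE k i hi hki)⁻¹)
  | T_comm (k l : Fin n) (hk : m ≤ (k : ℕ)) (hl : (l : ℕ) < m) (hkl : k ≠ l)
      (hk0 : (k : ℕ) ≠ 0) (hl0 : (l : ℕ) ≠ 0) :
      R₃ n m (wT n m * wE k l hl hkl * wT n m * (wE k l hl hkl)⁻¹)
  | T_inv (k l : Fin n) (hk : m ≤ (k : ℕ)) (hl : (l : ℕ) < m) (hkl : k ≠ l)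
      (h0 : (k : ℕ) = 0 ∨ (l : ℕ) = 0) :
      R₃ n m (wT n m * wE k l hl hkl * wT n m * ((wE k l hl hkl)⁻¹)⁻¹)

/-- The set of relators `R_{1,m} ∪ R_{2,m} ∪ R_{3,m}`. -/
def relators (n m : ℕ) : Set (FreeGroup (Gen n m)) :=
  {r | R₁ n m r} ∪ {r | R₂ n m r} ∪ {r | R₃ n m r}

end BlockTriangular

/-!
The presented group maps to `G_m` because the relators hold for the matrices, and onto it because the
Euclidean algorithm on columns reduces every matrix of `G_m` to the identity (`blockGroup_le`). The
content of the theorem is injectivity, which is stated as `IsFaithfulPresentation n m` and proved by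
induction on `m` in two kinds of steps.

* From `GL_m(ℤ)` to `G_m ≤ GL_n(ℤ)` (`isFaithfulPresentation_of_square`): by `R_{3,m}` every element
  of the presented group is a product of an element of the subgroup generated by the `E_kl` with
  `k > m`, which is abelian by `R_{1,m}`, and an element of the subgroup generated by `T_1` and the
  `E_ij` with `i, j ≤ m`. If the product acts trivially, so does each factor.

* From `G_r ≤ GL_{r+1}(ℤ)` to `GL_{r+1}(ℤ)` (`isFaithfulPresentation_square`): `G_r` is the
  stabilizer of the last basis vector `e_r`. Let `P` be the presented group and `L` its subgroup
  `lineSubgroup`, the presumed stabilizer of the line of `e_r`. If there is a map `s` from nonzero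
  integral vectors to `P ⧸ L` which is equivariant under `P` and sends `e_r` to the trivial coset, then
  an element whose matrix fixes `e_r` lies in `L`; as `L` is at most twice as large as the subgroup
  generated by the generators of `G_r`, the kernel lies in the latter, where the induction hypothesis
  applies.

The map `s` is `cosetSection`: a vector is reduced by steps `v_i ↦ v_i ∓ v_j` with
`0 < |v_j| ≤ |v_i|`, which lower the `ℓ¹` norm, until one nonzero entry is left. That the result does
not depend on the steps (`wellDefinedBelow`) is a peak reduction argument, by induction on the norm:
two reductions of the same vector are joined by vectors of smaller norm (`redValue_eq`), by means of
the relations `[E_ij, E_kl] = 1`, `[E_ij, E_jl] = E_il` and the braid relation. The Weyl elements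
`E_ij E_ji⁻¹ E_ij` act like signed permutations, and the relation `(E_12 E_21⁻¹ E_12) ^ 4 = 1` enters
when the sign change of the last coordinate is shown to normalize the stabilizer of `e_r`.
-/

namespace BlockTriangular

/-! ### Steinberg relations, Weyl elements and monomial elements -/

section Steinberg

variable {G : Type} [Group G]

/-- The element `E_ij E_ji⁻¹ E_ij`. For elementary matrices it sends `e_i` to `-e_j` and `e_j` to
`e_i`. -/
def weyl (E : ℕ → ℕ → G) (i j : ℕ) : G := E i j * (E j i)⁻¹ * E i j

/-- The Steinberg relations among `E_ij`, `i ≠ j`, `i, j < m`, together with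
`weyl E i j * weyl E j i = 1` for all pairs of indices. The family is total on `ℕ × ℕ`; its values
outside the range are unconstrained. -/
structure SteinbergRel (m : ℕ) (E : ℕ → ℕ → G) : Prop where
  comm : ∀ i j k l, i < m → j < m → k < m → l < m → i ≠ j → k ≠ l → i ≠ l → j ≠ k →
    Commute (E i j) (E k l)
  mul : ∀ i j k, i < m → j < m → k < m → i ≠ j → j ≠ k → i ≠ k →
    E i j * E j k = E i k * E j k * E i j
  weyl_mul : ∀ i j, i < m → j < m → i ≠ j → weyl E i j * weyl E j i = 1

theorem zpow_mul_zpow_of_central {x y z : G} (h : x * y = z * y * x) (hx : Commute x z)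
    (hy : Commute y z) (a b : ℤ) : x ^ a * y ^ b = z ^ (a * b) * y ^ b * x ^ a := by
  have h1 : x * y ^ b * x⁻¹ = z ^ b * y ^ b := by
    rw [← conj_zpow, h, mul_inv_cancel_right, (hy.symm).mul_zpow]
  have h2 : (y ^ b)⁻¹ * x * y ^ b = z ^ b * x := by
    rw [mul_assoc, show x * y ^ b = z ^ b * y ^ b * x by rw [← h1]; group,
      ((hy.zpow_zpow b b).symm).eq]
    group
  have h3 : (y ^ b)⁻¹ * x ^ a * y ^ b = z ^ (a * b) * x ^ a := by
    have := conj_zpow (a := (y ^ b)⁻¹) (b := x) (i := a)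
    rw [inv_inv] at this
    rw [← this, h2, ((hx.symm.zpow_left b)).mul_zpow, ← zpow_mul, mul_comm b a]
  rw [((hy.zpow_zpow b (a * b)).symm).eq, mul_assoc, ← h3]
  group

variable {m : ℕ} {E : ℕ → ℕ → G}

theorem SteinbergRel.zpow_mul_zpow (h : SteinbergRel m E) {i j k : ℕ} (hi : i < m) (hj : j < m)
    (hk : k < m) (hij : i ≠ j) (hjk : j ≠ k) (hik : i ≠ k) (a b : ℤ) :
    E i j ^ a * E j k ^ b = E i k ^ (a * b) * E j k ^ b * E i j ^ a :=
  zpow_mul_zpow_of_central (h.mul i j k hi hj hk hij hjk hik)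
    (h.comm i j i k hi hj hi hk hij hik hik hij.symm)
    (h.comm j k i k hj hk hi hk hjk hik hjk hik.symm) a b

/-- Conjugation by `weyl E i j` of the generators which share exactly one index with it. This uses
only the Steinberg relations, hence applies before `weyl E i j * weyl E j i = 1` is known. -/
theorem weyl_conj_of_steinberg
    (hc : ∀ i j k l, i < m → j < m → k < m → l < m → i ≠ j → k ≠ l → i ≠ l → j ≠ k →
      Commute (E i j) (E k l))
    (hs : ∀ i j k, i < m → j < m → k < m → i ≠ j → j ≠ k → i ≠ k →
      E i j * E j k = E i k * E j k * E i j)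
    {i j k : ℕ} (hi : i < m) (hj : j < m) (hk : k < m) (hij : i ≠ j) (hik : i ≠ k) (hjk : j ≠ k) :
    weyl E i j * E i k = (E j k)⁻¹ * weyl E i j ∧ weyl E i j * E j k = E i k * weyl E i j ∧
    weyl E i j * E k i = (E k j)⁻¹ * weyl E i j ∧ weyl E i j * E k j = E k i * weyl E i j := by
  have ax : SemiconjBy (E i j) (E i k) (E i k) := hc i j i k hi hj hi hk hij hik hik hij.symm
  have aq : SemiconjBy (E i j) (E k j) (E k j) := hc i j k j hi hj hk hj hij hjk.symm hij hjk
  have ay : SemiconjBy (E i j) (E j k) (E i k * E j k) := hs i j k hi hj hk hij hjk hik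
  have ap : SemiconjBy (E i j) (E k i) ((E k j)⁻¹ * E k i) := by
    rw [SemiconjBy, mul_assoc, eq_inv_mul_iff_mul_eq, ← mul_assoc]
    exact (hs k i j hk hi hj hik.symm hij hjk.symm).symm
  have by' : SemiconjBy (E j i) (E j k) (E j k) := hc j i j k hj hi hj hk hij.symm hjk hjk hij
  have bp : SemiconjBy (E j i) (E k i) (E k i) :=
    hc j i k i hj hi hk hi hij.symm hik.symm hij.symm hik
  have bx : SemiconjBy (E j i) (E i k) (E j k * E i k) := hs j i k hj hi hk hij.symm hik hjk
  have bq : SemiconjBy (E j i) (E k j) ((E k i)⁻¹ * E k j) := by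
    rw [SemiconjBy, mul_assoc, eq_inv_mul_iff_mul_eq, ← mul_assoc]
    exact (hs k j i hk hj hi hjk.symm hij.symm hik.symm).symm
  have xy : Commute (E i k) (E j k) := hc i k j k hi hk hj hk hik hjk hik hjk.symm
  have pq : Commute (E k i) (E k j) := hc k i k j hk hi hk hj hik.symm hjk.symm hjk.symm hik
  have bx' : SemiconjBy (E j i)⁻¹ (E i k) ((E j k)⁻¹ * E i k) := by
    simpa using (by'.inv_right.mul_right bx).inv_symm_left
  have bq' : SemiconjBy (E j i)⁻¹ (E k j) (E k i * E k j) := by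
    simpa using (bp.mul_right bq).inv_symm_left
  have by2 := by'.inv_symm_left
  have bp2 := bp.inv_symm_left
  have xy' : (E j k)⁻¹ * E i k * E j k = E i k := by
    rw [mul_assoc, xy.eq, inv_mul_cancel_left]
  have pq' : (E k j)⁻¹ * E k i * E k j = E k i := by
    rw [mul_assoc, pq.eq, inv_mul_cancel_left]
  have h1 : SemiconjBy (E i j) ((E j k)⁻¹ * E i k) (E j k)⁻¹ := by
    simpa using ay.inv_right.mul_right ax
  have h2 : SemiconjBy (E j i)⁻¹ (E i k * E j k) (E i k) := by
    simpa only [xy'] using bx'.mul_right by2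
  have h3 : SemiconjBy (E j i)⁻¹ ((E k j)⁻¹ * E k i) (E k j)⁻¹ := by
    have := bq'.inv_right.mul_right bp2
    rwa [mul_inv_rev, inv_mul_cancel_right] at this
  have h4 : SemiconjBy (E i j) (E k i * E k j) (E k i) := by
    simpa only [pq'] using ap.mul_right aq
  exact ⟨(h1.mul_left bx').mul_left ax, (ax.mul_left h2).mul_left ay,
    (aq.inv_right.mul_left h3).mul_left ap, (h4.mul_left bq').mul_left aq⟩

/-- In the presence of a third index the braid relation is a consequence of the Steinberg relations:
writing `E_ij` as a commutator through `k`, one sees that `weyl E i j` conjugates `E_ij` to `E_ji⁻¹`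
and conversely, and then conjugates `weyl E i j` by itself. -/
theorem weyl_mul_weyl_of_steinberg
    (hc : ∀ i j k l, i < m → j < m → k < m → l < m → i ≠ j → k ≠ l → i ≠ l → j ≠ k →
      Commute (E i j) (E k l))
    (hs : ∀ i j k, i < m → j < m → k < m → i ≠ j → j ≠ k → i ≠ k →
      E i j * E j k = E i k * E j k * E i j)
    {i j k : ℕ} (hi : i < m) (hj : j < m) (hk : k < m) (hij : i ≠ j) (hik : i ≠ k) (hjk : j ≠ k) :
    weyl E i j * weyl E j i = 1 := by
  obtain ⟨h1, h2, h3, h4⟩ := weyl_conj_of_steinberg hc hs hi hj hk hij hik hjk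
  have conj : ∀ {x y : G}, weyl E i j * x = y * weyl E i j → SemiconjBy (weyl E i j) x y := id
  replace h1 := conj h1
  replace h2 := conj h2
  replace h3 := conj h3
  replace h4 := conj h4
  have comm_eq : ∀ {a b c : ℕ}, a < m → b < m → c < m → a ≠ b → b ≠ c → a ≠ c →
      E a b * E b c * (E a b)⁻¹ * (E b c)⁻¹ = E a c := fun ha hb hc' hab hbc hac => by
    rw [hs _ _ _ ha hb hc' hab hbc hac]; group
  have zpow_eq : ∀ {a b c : ℕ}, a < m → b < m → c < m → a ≠ b → b ≠ c → a ≠ c → ∀ s t : ℤ,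
      E a b ^ s * E b c ^ t = E a c ^ (s * t) * E b c ^ t * E a b ^ s :=
    fun ha hb hc' hab hbc hac => zpow_mul_zpow_of_central (hs _ _ _ ha hb hc' hab hbc hac)
      (hc _ _ _ _ ha hb ha hc' hab hac hac hab.symm)
      (hc _ _ _ _ hb hc' ha hc' hbc hac hbc hac.symm)
  have ha : SemiconjBy (weyl E i j) (E i j) (E j i)⁻¹ := by
    have := ((h1.mul_right h4).mul_right h1.inv_right).mul_right h4.inv_right
    rw [comm_eq hi hk hj hik hjk.symm hij] at this
    have hz := zpow_eq hj hk hi hjk hik.symm hij.symm (-1) 1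
    simp only [zpow_neg_one, zpow_one, mul_one] at hz
    rwa [hz, inv_inv, inv_mul_cancel_right, mul_inv_cancel_right] at this
  have hb : SemiconjBy (weyl E i j) (E j i) (E i j)⁻¹ := by
    have := ((h2.mul_right h3).mul_right h2.inv_right).mul_right h3.inv_right
    rw [comm_eq hj hk hi hjk hik.symm hij.symm] at this
    have hz := zpow_eq hi hk hj hik hjk.symm hij 1 (-1)
    simp only [zpow_neg_one, zpow_one, one_mul] at hz
    rwa [hz, inv_inv, mul_inv_cancel_right, inv_mul_cancel_right] at this
  have hw : weyl E i j = (E j i)⁻¹ * E i j * (E j i)⁻¹ := by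
    have h : SemiconjBy (weyl E i j) (weyl E i j) ((E j i)⁻¹ * ((E i j)⁻¹)⁻¹ * (E j i)⁻¹) :=
      (ha.mul_right hb.inv_right).mul_right ha
    rw [inv_inv] at h
    exact mul_right_cancel h
  rw [hw, weyl]
  group

/-- `g` permutes the generators `E_kl` up to inversion in the way a signed permutation matrix does:
it stands for the matrix that sends `e_k` to `χ k • e_(σ k)`. -/
structure IsMonomial (m : ℕ) (E : ℕ → ℕ → G) (g : G) (σ : Equiv.Perm ℕ) (χ : ℕ → ℤˣ) : Prop where
  lt_iff : ∀ k, σ k < m ↔ k < m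
  conj : ∀ k l, k < m → l < m → k ≠ l →
    g * E k l = E (σ k) (σ l) ^ ((χ k * χ l : ℤˣ) : ℤ) * g

theorem IsMonomial.zpow {g : G} {σ : Equiv.Perm ℕ} {χ : ℕ → ℤˣ} (h : IsMonomial m E g σ χ)
    {k l : ℕ} (hk : k < m) (hl : l < m) (hkl : k ≠ l) (a : ℤ) :
    g * E k l ^ a = E (σ k) (σ l) ^ ((χ k * χ l : ℤˣ) * a : ℤ) * g := by
  have : SemiconjBy g (E k l) _ := h.conj k l hk hl hkl
  simpa [zpow_mul] using (this.zpow_right a).eq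

theorem IsMonomial.weyl {g : G} {σ : Equiv.Perm ℕ} {χ : ℕ → ℤˣ} (h : IsMonomial m E g σ χ)
    {k l : ℕ} (hk : k < m) (hl : l < m) (hkl : k ≠ l) :
    g * weyl E k l = weyl E (σ k) (σ l) ^ ((χ k * χ l : ℤˣ) : ℤ) * g := by
  have h1 : SemiconjBy g (E k l) _ := h.conj k l hk hl hkl
  have h2 : SemiconjBy g (E l k) _ := h.conj l k hl hk hkl.symm
  have := ((h1.mul_right h2.inv_right).mul_right h1).eq
  rw [BlockTriangular.weyl, this, mul_comm (χ l)]
  rcases Int.units_eq_one_or (χ k * χ l) with h | h <;> simp [h, BlockTriangular.weyl, mul_assoc]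

theorem SteinbergRel.weyl_eq_inv (h : SteinbergRel m E) {i j : ℕ} (hi : i < m) (hj : j < m)
    (hij : i ≠ j) : weyl E i j = (weyl E j i)⁻¹ :=
  eq_inv_of_mul_eq_one_left (h.weyl_mul i j hi hj hij)

theorem SteinbergRel.isMonomial_weyl (h : SteinbergRel m E) {i j : ℕ} (hi : i < m) (hj : j < m)
    (hij : i ≠ j) :
    IsMonomial m E (weyl E i j) (Equiv.swap i j) (fun k => if k = i then -1 else 1) where
  lt_iff k := by
    rw [Equiv.swap_apply_def]; split_ifs <;> simp_all
  conj k l hk hl hkl := by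
    have hw : weyl E i j = (E j i)⁻¹ * E i j * (E j i)⁻¹ := by
      rw [h.weyl_eq_inv hi hj hij, weyl]; group
    have hij1 : weyl E i j * E i j = (E j i)⁻¹ * weyl E i j := by
      conv_lhs => rw [hw]
      rw [weyl]; group
    have hji1 : weyl E i j * E j i = (E i j)⁻¹ * weyl E i j := by
      conv_lhs => rw [hw]
      rw [weyl]; group
    have key := fun k hk => weyl_conj_of_steinberg h.comm h.mul (k := k) hi hj hk hij
    by_cases hki : k = i
    · subst hki
      by_cases hlj : l = j
      · subst hlj; simpa [hkl.symm] using hij1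
      · simpa [Equiv.swap_apply_of_ne_of_ne hkl.symm hlj, hkl.symm] using
          (key l hl hkl (Ne.symm hlj)).1
    by_cases hkj : k = j
    · subst hkj
      by_cases hli : l = i
      · subst hli; simpa [hkl] using hji1
      · simpa [Equiv.swap_apply_of_ne_of_ne hli hkl.symm, hki, hli] using
          (key l hl (Ne.symm hli) hkl).2.1
    rw [Equiv.swap_apply_of_ne_of_ne hki hkj]
    by_cases hli : l = i
    · subst hli; simpa [hki] using (key k hk (Ne.symm hki) (Ne.symm hkj)).2.2.1
    by_cases hlj : l = j
    · subst hlj; simpa [hki, hli] using (key k hk (Ne.symm hki) (Ne.symm hkj)).2.2.2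
    have c1 := h.comm i j k l hi hj hk hl hij hkl (Ne.symm hli) (Ne.symm hkj)
    have c2 := h.comm j i k l hj hi hk hl hij.symm hkl (Ne.symm hlj) (Ne.symm hki)
    simpa [Equiv.swap_apply_of_ne_of_ne hli hlj, hki, hli, weyl] using
      ((c1.mul_left c2.inv_left).mul_left c1).eq

end Steinberg
/-! ### Reductions of integral vectors -/

section Norm

/-- The `ℓ¹` norm of the first `m` coordinates. The other coordinates are ignored. -/
def l1norm (m : ℕ) (v : ℕ → ℤ) : ℕ := ∑ i ∈ Finset.range m, (v i).natAbs

theorem l1norm_update {m i : ℕ} (hi : i < m) (v : ℕ → ℤ) (y : ℤ) :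
    l1norm m (Function.update v i y) + (v i).natAbs = l1norm m v + y.natAbs := by
  have h := Finset.mem_range.2 hi
  simp only [l1norm]
  rw [← Finset.add_sum_erase _ _ h, ← Finset.add_sum_erase _ (fun i => (v i).natAbs) h]
  have : ∑ x ∈ (Finset.range m).erase i, (Function.update v i y x).natAbs =
      ∑ x ∈ (Finset.range m).erase i, (v x).natAbs :=
    Finset.sum_congr rfl fun x hx => by
      rw [Function.update_of_ne (Finset.ne_of_mem_erase hx)]
  rw [this, Function.update_self]
  omega

theorem l1norm_pos {m : ℕ} {v : ℕ → ℤ} : 0 < l1norm m v ↔ ∃ i < m, v i ≠ 0 := by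
  simp [l1norm, Finset.sum_pos_iff]

/-- The vector obtained from `v` by adding `a` times the entry `j` to the entry `i`, that is, the
image of `v` under `E_ij ^ a`. -/
def addRow (v : ℕ → ℤ) (i j : ℕ) (a : ℤ) : ℕ → ℤ := Function.update v i (v i + a * v j)

@[simp] theorem addRow_self (v : ℕ → ℤ) (i j : ℕ) (a : ℤ) :
    addRow v i j a i = v i + a * v j := by simp [addRow]

theorem addRow_of_ne (v : ℕ → ℤ) {i k : ℕ} (j : ℕ) (a : ℤ) (h : k ≠ i) :
    addRow v i j a k = v k := by simp [addRow, h]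

theorem addRow_zero (v : ℕ → ℤ) (i j : ℕ) : addRow v i j 0 = v := by simp [addRow]

theorem addRow_addRow_same (v : ℕ → ℤ) {i j : ℕ} (hij : i ≠ j) (a b : ℤ) :
    addRow (addRow v i j a) i j b = addRow v i j (a + b) := by
  simp [addRow, hij.symm, add_mul, add_assoc]

theorem l1norm_addRow {m i : ℕ} (hi : i < m) (v : ℕ → ℤ) (j : ℕ) (a : ℤ) :
    l1norm m (addRow v i j a) + (v i).natAbs = l1norm m v + (v i + a * v j).natAbs :=
  l1norm_update hi v _

theorem natAbs_sub_of_pos {ε p q : ℤ} (hε : ε = 1 ∨ ε = -1) (h : 0 < ε * (p * q))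
    (hpq : q.natAbs ≤ p.natAbs) : (p + -ε * q).natAbs + q.natAbs = p.natAbs := by
  rcases hε with rfl | rfl
  · rcases pos_and_pos_or_neg_and_neg_of_mul_pos (show 0 < p * q by linarith) with h | h <;> omega
  · rcases mul_neg_iff.1 (show p * q < 0 by linarith) with h | h <;> omega

theorem natAbs_add_of_nonneg {ε p q : ℤ} (hε : ε = 1 ∨ ε = -1) (h : 0 ≤ ε * (p * q)) :
    (p + ε * q).natAbs = p.natAbs + q.natAbs := by
  rcases hε with rfl | rfl
  · rcases mul_nonneg_iff.1 (show 0 ≤ p * q by linarith) with h | h <;> omega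
  · rcases mul_nonpos_iff.1 (show p * q ≤ 0 by linarith) with h | h <;> omega

/-- Subtracting `± v j` from `v i` is a norm reducing step: both entries are nonzero and
`|v j| ≤ |v i|`. -/
structure IsReduction (m : ℕ) (v : ℕ → ℤ) (i j : ℕ) : Prop where
  left_lt : i < m
  right_lt : j < m
  ne : i ≠ j
  ne_zero : v j ≠ 0
  le : (v j).natAbs ≤ (v i).natAbs

/-- The sign `ε` for which `|v i - ε * v j| = |v i| - |v j|` in a reduction. -/
def redSign (v : ℕ → ℤ) (i j : ℕ) : ℤ := (v i * v j).sign

theorem IsReduction.left_ne_zero {m : ℕ} {v : ℕ → ℤ} {i j : ℕ} (h : IsReduction m v i j) :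
    v i ≠ 0 := by
  have := h.ne_zero; have := h.le; omega

theorem IsReduction.redSign_eq {m : ℕ} {v : ℕ → ℤ} {i j : ℕ} (h : IsReduction m v i j) :
    redSign v i j = 1 ∨ redSign v i j = -1 := by
  have := mul_ne_zero h.left_ne_zero h.ne_zero
  rcases lt_or_gt_of_ne this with h | h
  · exact Or.inr (Int.sign_eq_neg_one_of_neg h)
  · exact Or.inl (Int.sign_eq_one_of_pos h)

theorem IsReduction.pos {m : ℕ} {v : ℕ → ℤ} {i j : ℕ} (h : IsReduction m v i j) :
    0 < redSign v i j * (v i * v j) := by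
  rw [redSign, Int.sign_mul_self_eq_abs]
  exact abs_pos.2 (mul_ne_zero h.left_ne_zero h.ne_zero)

theorem redSign_eq_of_pos {ε : ℤ} {v : ℕ → ℤ} {i j : ℕ} (hε : ε = 1 ∨ ε = -1)
    (h : 0 < ε * (v i * v j)) : redSign v i j = ε := by
  rcases hε with rfl | rfl
  · exact Int.sign_eq_one_of_pos (by linarith)
  · exact Int.sign_eq_neg_one_of_neg (by linarith)

/-- The vector obtained from `v` by the reduction `(i, j)`. -/
def reduce (v : ℕ → ℤ) (i j : ℕ) : ℕ → ℤ := addRow v i j (-redSign v i j)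

theorem reduce_of_ne (v : ℕ → ℤ) {i k : ℕ} (j : ℕ) (h : k ≠ i) : reduce v i j k = v k :=
  addRow_of_ne v j _ h

theorem IsReduction.l1norm_reduce {m : ℕ} {v : ℕ → ℤ} {i j : ℕ} (h : IsReduction m v i j) :
    l1norm m (reduce v i j) + (v j).natAbs = l1norm m v := by
  have h1 := l1norm_addRow h.left_lt v j (-redSign v i j)
  have h2 := natAbs_sub_of_pos h.redSign_eq h.pos h.le
  rw [reduce]; omega

theorem IsReduction.l1norm_reduce_lt {m : ℕ} {v : ℕ → ℤ} {i j : ℕ} (h : IsReduction m v i j) :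
    l1norm m (reduce v i j) < l1norm m v := by
  have h1 := h.l1norm_reduce
  have := h.ne_zero
  omega

theorem IsReduction.l1norm_reduce_pos {m : ℕ} {v : ℕ → ℤ} {i j : ℕ} (h : IsReduction m v i j) :
    0 < l1norm m (reduce v i j) :=
  l1norm_pos.2 ⟨j, h.right_lt, by rw [reduce_of_ne v j h.ne.symm]; exact h.ne_zero⟩

theorem isReduction_or {m : ℕ} {v : ℕ → ℤ} {i j : ℕ} (hi : i < m) (hj : j < m) (hij : i ≠ j)
    (hvi : v i ≠ 0) (hvj : v j ≠ 0) : IsReduction m v i j ∨ IsReduction m v j i :=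
  (le_total (v j).natAbs (v i).natAbs).imp (fun h => ⟨hi, hj, hij, hvj, h⟩)
    fun h => ⟨hj, hi, hij.symm, hvi, h⟩

end Norm

/-! ### The coset attached to a vector -/

section Section

variable {G Q : Type} [Group G] [MulAction G Q]

open Classical in
/-- The point of `Q` attached to a nonzero vector `v`: reduce `v`, by steps chosen arbitrarily, to a
vector with a single nonzero entry, say at `j`, start from `c j` and undo the steps by the
corresponding elements `E_ij ^ (±1)`. The value at a vector that vanishes below `m` is junk. -/
noncomputable def cosetSection (m : ℕ) (E : ℕ → ℕ → G) (c : ℕ → Q) (v : ℕ → ℤ) : Q :=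
  if h : ∃ p : ℕ × ℕ, IsReduction m v p.1 p.2 then
    E h.choose.1 h.choose.2 ^ redSign v h.choose.1 h.choose.2 •
      cosetSection m E c (reduce v h.choose.1 h.choose.2)
  else if h : ∃ j < m, v j ≠ 0 then c h.choose else c 0
termination_by l1norm m v
decreasing_by exact h.choose_spec.l1norm_reduce_lt

/-- The points `c j` behave as the lines spanned by the basis vectors `e_j` do: `E_kl` with `l ≠ j`
fixes `c j`, and the Weyl elements permute the `c j`. -/
structure IsBase (m : ℕ) (E : ℕ → ℕ → G) (c : ℕ → Q) : Prop where
  fix : ∀ k l j, k < m → l < m → j < m → k ≠ l → l ≠ j → E k l • c j = c j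
  weyl : ∀ i j k, i < m → j < m → k < m → i ≠ j → weyl E i j • c k = c (Equiv.swap i j k)

variable {m : ℕ} {E : ℕ → ℕ → G} {c : ℕ → Q}

theorem cosetSection_of_not_isReduction {v : ℕ → ℤ} (h : ∀ i j, ¬ IsReduction m v i j) {j : ℕ}
    (hj : j < m) (hv : v j ≠ 0) : cosetSection m E c v = c j := by
  have h' : ∃ j < m, v j ≠ 0 := ⟨j, hj, hv⟩
  rw [cosetSection, dif_neg (fun ⟨p, hp⟩ => h _ _ hp), dif_pos h']
  by_contra hne
  have hne' : h'.choose ≠ j := fun e => hne (by rw [e])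
  exact (isReduction_or h'.choose_spec.1 hj hne' h'.choose_spec.2 hv).elim (h _ _) (h _ _)

/-- On vectors of norm less than `N` every reduction, not only the chosen one, computes
`cosetSection`. -/
def WellDefinedBelow (m : ℕ) (E : ℕ → ℕ → G) (c : ℕ → Q) (N : ℕ) : Prop :=
  ∀ v, l1norm m v < N → ∀ i j, IsReduction m v i j →
    cosetSection m E c v = E i j ^ redSign v i j • cosetSection m E c (reduce v i j)

theorem WellDefinedBelow.eq_smul {N : ℕ} (hN : WellDefinedBelow m E c N) {v : ℕ → ℤ}
    (hv : l1norm m v < N) {i j : ℕ} (h : IsReduction m v i j) {ε : ℤ} (hε : ε = 1 ∨ ε = -1)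
    (hpos : 0 < ε * (v i * v j)) :
    cosetSection m E c v = E i j ^ ε • cosetSection m E c (addRow v i j (-ε)) := by
  have := hN v hv i j h
  rwa [reduce, redSign_eq_of_pos hε hpos] at this

theorem zpow_smul_eq_self {g : G} {q : Q} (h : g • q = q) (a : ℤ) : g ^ a • q = q :=
  (MulAction.stabilizer G q).zpow_mem (MulAction.mem_stabilizer_iff.2 h) a

/-- `E_ij` fixes the point attached to a vector whose entry `j` vanishes. -/
theorem WellDefinedBelow.smul_eq_self (hE : SteinbergRel m E) (hc : IsBase m E c) {N : ℕ}
    (hN : WellDefinedBelow m E c N) {i j : ℕ} (hi : i < m) (hj : j < m) (hij : i ≠ j) :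
    ∀ v : ℕ → ℤ, l1norm m v < N → 0 < l1norm m v → v j = 0 →
      E i j • cosetSection m E c v = cosetSection m E c v := by
  intro v
  induction hn : l1norm m v using Nat.strong_induction_on generalizing v i with
  | _ n ih =>
    subst hn
    intro hv hpos hvj
    by_cases hred : ∃ k l, IsReduction m v k l
    · obtain ⟨k, l, hkl⟩ := hred
      have hlj : l ≠ j := fun e => hkl.ne_zero (e ▸ hvj)
      have hkj : k ≠ j := fun e => hkl.left_ne_zero (e ▸ hvj)
      have hlt := hkl.l1norm_reduce_lt
      have key : ∀ i', i' < m → i' ≠ j → E i' j • cosetSection m E c (reduce v k l) =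
          cosetSection m E c (reduce v k l) := fun i' hi' hij' =>
        ih _ hlt hi' hij' _ rfl (hlt.trans hv) hkl.l1norm_reduce_pos
          (by rw [reduce_of_ne v l hkj.symm, hvj])
      rw [hN v hv k l hkl, smul_smul]
      by_cases hli : l = i
      · subst hli
        have h1 := hE.zpow_mul_zpow hkl.left_lt hi hj hkl.ne hij hkj (redSign v k l) 1
        have h3 := (hE.comm k l k j hkl.left_lt hi hkl.left_lt hj hkl.ne hkj hkj
          hkl.ne.symm).zpow_zpow (redSign v k l) (-redSign v k l)
        have h2 : E l j * E k l ^ redSign v k l =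
            E k l ^ redSign v k l * E k j ^ (-redSign v k l) * E l j := by
          rw [mul_one, zpow_one, mul_assoc, ← inv_mul_eq_iff_eq_mul, ← mul_assoc] at h1
          rw [← h1, h3.eq, zpow_neg]
        rw [h2, mul_smul, mul_smul, key _ hi hij, zpow_smul_eq_self (key _ hkl.left_lt hkj)]
      · have hcm := (hE.comm i j k l hi hj hkl.left_lt hkl.right_lt hij hkl.ne (Ne.symm hli)
          hkj.symm).zpow_right (redSign v k l)
        rw [hcm.eq, mul_smul, key _ hi hij]
    · push Not at hred
      obtain ⟨k, hk, hvk⟩ := l1norm_pos.1 hpos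
      rw [cosetSection_of_not_isReduction hred hk hvk]
      exact hc.fix _ _ _ hi hj hk hij (fun e => hvk (e ▸ hvj))

/-- Monomial elements preserve the norm and carry reductions to reductions, so `cosetSection` is
equivariant under them. -/
theorem WellDefinedBelow.smul_monomial {N : ℕ}
    (hN : WellDefinedBelow m E c N) {g : G} {σ : Equiv.Perm ℕ} {χ : ℕ → ℤˣ}
    (hg : IsMonomial m E g σ χ) (hgc : ∀ k < m, g • c k = c (σ k)) :
    ∀ v u : ℕ → ℤ, l1norm m v < N → 0 < l1norm m v → (∀ k, u (σ k) = χ k * v k) →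
      l1norm m u = l1norm m v ∧ g • cosetSection m E c v = cosetSection m E c u := by
  have habs : ∀ (a : ℤˣ) (b : ℤ), ((a : ℤ) * b).natAbs = b.natAbs := fun a b => by
    rw [Int.natAbs_mul, Int.units_natAbs, one_mul]
  have hnorm : ∀ v u : ℕ → ℤ, (∀ k, u (σ k) = χ k * v k) → l1norm m u = l1norm m v := by
    intro v u huv
    rw [l1norm, l1norm]
    symm
    refine Finset.sum_equiv σ (fun k => by simpa using (hg.lt_iff k).symm) fun k _ => ?_
    rw [huv, habs]
  intro v
  induction hn : l1norm m v using Nat.strong_induction_on generalizing v with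
  | _ n ih =>
    subst hn
    intro u hv hpos huv
    have hnu := hnorm v u huv
    refine ⟨hnu, ?_⟩
    by_cases hred : ∃ k l, IsReduction m v k l
    · obtain ⟨k, l, hkl⟩ := hred
      have hkl' : IsReduction m u (σ k) (σ l) :=
        ⟨(hg.lt_iff _).2 hkl.left_lt, (hg.lt_iff _).2 hkl.right_lt, fun e => hkl.ne (σ.injective e),
          by rw [huv]; exact mul_ne_zero (Units.ne_zero _) hkl.ne_zero,
          by rw [huv, huv, habs, habs]; exact hkl.le⟩
      have hs : redSign u (σ k) (σ l) = ((χ k * χ l : ℤˣ) : ℤ) * redSign v k l := by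
        rw [redSign, redSign, huv, huv]
        rcases Int.units_eq_one_or (χ k) with h | h <;>
          rcases Int.units_eq_one_or (χ l) with h' | h' <;> simp [h, h']
      have hlt := hkl.l1norm_reduce_lt
      have := (ih _ hlt (reduce v k l) rfl (reduce u (σ k) (σ l)) (hlt.trans hv)
        hkl.l1norm_reduce_pos (fun i => by
          by_cases hik : i = k
          · subst hik
            rw [reduce, reduce, addRow_self, addRow_self, hs, huv, huv]
            have h2 : ((χ l : ℤˣ) : ℤ) * ((χ l : ℤˣ) : ℤ) = 1 := by
              rw [← Units.val_mul, Int.units_mul_self, Units.val_one]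
            push_cast
            linear_combination (-(χ i : ℤ) * redSign v i l * v l) * h2
          · rw [reduce_of_ne _ _ hik, reduce_of_ne _ _ (fun e => hik (σ.injective e)), huv])).2
      rw [hN v hv k l hkl, hN u (hnu ▸ hv) _ _ hkl', hs, smul_smul,
        hg.zpow hkl.left_lt hkl.right_lt hkl.ne, mul_smul, this]
    · push Not at hred
      obtain ⟨k, hk, hvk⟩ := l1norm_pos.1 hpos
      rw [cosetSection_of_not_isReduction hred hk hvk, hgc k hk]
      refine (cosetSection_of_not_isReduction (fun i j h => ?_) ((hg.lt_iff k).2 hk)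
        (by rw [huv]; exact mul_ne_zero (Units.ne_zero _) hvk)).symm
      obtain ⟨i, rfl⟩ := σ.surjective i
      obtain ⟨j, rfl⟩ := σ.surjective j
      refine hred i j ⟨(hg.lt_iff i).1 h.left_lt, (hg.lt_iff j).1 h.right_lt, fun e => h.ne (by rw [e]), ?_, ?_⟩
      · have := h.ne_zero
        rw [huv] at this
        exact right_ne_zero_of_mul this
      · have := h.le
        rwa [huv, huv, habs, habs] at this

end Section
/-! ### Independence of the reduction -/

section Peak

variable {G Q : Type} [Group G] [MulAction G Q] {m : ℕ} {E : ℕ → ℕ → G} {c : ℕ → Q}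

theorem WellDefinedBelow.weyl_smul (hE : SteinbergRel m E) (hc : IsBase m E c) {N : ℕ}
    (hN : WellDefinedBelow m E c N) {i j : ℕ} (hi : i < m) (hj : j < m) (hij : i ≠ j)
    {v u : ℕ → ℤ} (hv : l1norm m v < N) (hpos : 0 < l1norm m v) (hui : u i = v j)
    (huj : u j = -v i) (hu : ∀ k, k ≠ i → k ≠ j → u k = v k) :
    l1norm m u = l1norm m v ∧ weyl E i j • cosetSection m E c v = cosetSection m E c u := by
  refine hN.smul_monomial (hE.isMonomial_weyl hi hj hij) (fun k hk => hc.weyl i j k hi hj hk hij)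
    v u hv hpos fun k => ?_
  by_cases hki : k = i
  · subst hki; simp [huj]
  by_cases hkj : k = j
  · subst hkj; simp [hki, hui]
  rw [Equiv.swap_apply_of_ne_of_ne hki hkj, hu k hki hkj]
  simp [hki]

/-- Equivariance under `weyl E i j` and its inverse, with the sign as a parameter. -/
theorem WellDefinedBelow.weyl_smul_sign (hE : SteinbergRel m E) (hc : IsBase m E c) {N : ℕ}
    (hN : WellDefinedBelow m E c N) {i j : ℕ} (hi : i < m) (hj : j < m) (hij : i ≠ j)
    {ε : ℤ} (hε : ε = 1 ∨ ε = -1)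
    {v u : ℕ → ℤ} (hv : l1norm m v < N) (hpos : 0 < l1norm m v) (hui : u i = ε * v j)
    (huj : u j = -ε * v i) (hu : ∀ k, k ≠ i → k ≠ j → u k = v k) :
    (E i j ^ ε * E j i ^ (-ε) * E i j ^ ε) • cosetSection m E c v = cosetSection m E c u := by
  rcases hε with rfl | rfl
  · simpa [weyl] using (hN.weyl_smul hE hc hi hj hij hv hpos (by simpa using hui)
      (by simpa using huj) hu).2
  · have hw : (E i j ^ (-1 : ℤ) * E j i ^ (-(-1) : ℤ) * E i j ^ (-1 : ℤ)) = weyl E j i := by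
      rw [hE.weyl_eq_inv hj hi hij.symm, weyl]; group
    rw [hw]
    exact (hN.weyl_smul hE hc hj hi hij.symm hv hpos (by simpa using huj)
      (by simpa using hui) (fun k h h' => hu k h' h)).2

theorem SteinbergRel.braid_zpow (hE : SteinbergRel m E) {i j : ℕ} (hi : i < m) (hj : j < m)
    (hij : i ≠ j) {ε : ℤ} (hε : ε = 1 ∨ ε = -1) :
    E i j ^ ε * E j i ^ (-ε) * E i j ^ ε = E j i ^ (-ε) * E i j ^ ε * E j i ^ (-ε) := by
  have h := hE.weyl_eq_inv hi hj hij
  have h' := hE.weyl_eq_inv hj hi hij.symm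
  rcases hε with rfl | rfl
  · simpa [weyl, mul_assoc] using h
  · simpa [weyl, mul_assoc] using h'.symm

/-- `cosetSection` is equivariant under every step `E_ij ^ (±1)` between vectors of norm less
than `N`, whether or not the step is a reduction. -/
theorem WellDefinedBelow.smul_addRow (hE : SteinbergRel m E) (hc : IsBase m E c) {N : ℕ}
    (hN : WellDefinedBelow m E c N) {i j : ℕ} (hi : i < m) (hj : j < m) (hij : i ≠ j)
    {ε : ℤ} (hε : ε = 1 ∨ ε = -1) {v : ℕ → ℤ} (hpos : 0 < l1norm m v) (hv : l1norm m v < N)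
    (hv' : l1norm m (addRow v i j ε) < N) :
    E i j ^ ε • cosetSection m E c v = cosetSection m E c (addRow v i j ε) := by
  have hε2 : ε * ε = 1 := by rcases hε with rfl | rfl <;> norm_num
  have hεn : -ε = 1 ∨ -ε = -1 := by omega
  rcases eq_or_ne (v j) 0 with hj0 | hj0
  · rw [zpow_smul_eq_self (hN.smul_eq_self hE hc hi hj hij v hv hpos hj0)]
    simp [addRow, hj0]
  have hj2 : 0 < v j * v j := mul_self_pos.2 hj0
  rcases le_or_gt 0 (ε * (v i * v j)) with h | h
  · -- `v` is a reduction of its image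
    have hred : IsReduction m (addRow v i j ε) i j := by
      refine ⟨hi, hj, hij, by rwa [addRow_of_ne _ _ _ hij.symm], ?_⟩
      rw [addRow_self, addRow_of_ne _ _ _ hij.symm, natAbs_add_of_nonneg hε h]
      omega
    rw [hN.eq_smul hv' hred hε, addRow_addRow_same _ hij, add_neg_cancel, addRow_zero]
    rw [addRow_self, addRow_of_ne _ _ _ hij.symm]
    nlinarith
  rcases le_or_gt (v j).natAbs (v i).natAbs with hle | hlt
  · rw [hN.eq_smul hv ⟨hi, hj, hij, hj0, hle⟩ hεn (by linarith), neg_neg, smul_smul,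
      ← zpow_add, add_neg_cancel, zpow_zero, one_smul]
  · -- both ends reduce by `(j, i)`, and the braid relation compares the two reduced vectors
    have hi0 : v i ≠ 0 := fun e => by simp [e] at h
    have hred : IsReduction m v j i := ⟨hj, hi, hij.symm, hi0, hlt.le⟩
    have habs := natAbs_sub_of_pos (p := v j) (q := v i) hεn (by linarith) hlt.le
    rw [neg_neg] at habs
    have habs' : (v i + ε * v j).natAbs = (v j + ε * v i).natAbs := by
      rcases hε with rfl | rfl <;> omega
    have hred' : IsReduction m (addRow v i j ε) j i := by
      refine ⟨hj, hi, hij.symm, ?_, ?_⟩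
      · rw [addRow_self]; omega
      · rw [addRow_self, addRow_of_ne _ _ _ hij.symm]; omega
    have hlow : l1norm m (addRow v j i ε) < N := by
      have := hred.l1norm_reduce_lt
      rw [reduce, redSign_eq_of_pos hεn (by linarith), neg_neg] at this
      exact this.trans hv
    rw [hN.eq_smul hv hred hεn (by linarith), neg_neg,
      hN.eq_smul hv' hred' hε (by
        rw [addRow_self, addRow_of_ne _ _ _ hij.symm]
        have : 0 < v j * (v j + ε * v i) := by
          rcases lt_or_gt_of_ne hj0 with hneg | hpos'
          · exact mul_pos_of_neg_of_neg hneg (by rcases hε with rfl | rfl <;> omega)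
          · exact mul_pos hpos' (by rcases hε with rfl | rfl <;> omega)
        linear_combination this - (v j * v j) * hε2),
      smul_smul, ← inv_smul_eq_iff, ← zpow_neg, smul_smul, ← mul_assoc, ← hE.braid_zpow hi hj hij hε]
    refine hN.weyl_smul_sign hE hc hi hj hij hε hlow (l1norm_pos.2 ⟨i, hi, ?_⟩) ?_ ?_ ?_
    · rwa [addRow_of_ne _ _ _ hij]
    · rw [addRow_of_ne _ _ _ hij, addRow_self, addRow_self]
      linear_combination (-v i) * hε2
    · rw [addRow_self, addRow_self, addRow_of_ne _ _ _ hij.symm, addRow_of_ne _ _ _ hij]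
      linear_combination (-v j) * hε2
    · intro k hki hkj
      rw [addRow_of_ne _ _ _ hkj, addRow_of_ne _ _ _ hki, addRow_of_ne _ _ _ hkj]

/-- The value that the reduction `(i, j)` assigns to `v`. -/
noncomputable def redValue (m : ℕ) (E : ℕ → ℕ → G) (c : ℕ → Q) (v : ℕ → ℤ) (i j : ℕ) : Q :=
  E i j ^ redSign v i j • cosetSection m E c (reduce v i j)

/-- Reductions by commuting generators can be performed one after the other. -/
theorem redValue_eq_of_commute (hE : SteinbergRel m E) {v : ℕ → ℤ}
    (hN : WellDefinedBelow m E c (l1norm m v)) {i j k l : ℕ} (h : IsReduction m v i j)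
    (h' : IsReduction m v k l) (hik : i ≠ k) (hil : i ≠ l) (hjk : j ≠ k) :
    redValue m E c v i j = redValue m E c v k l := by
  have hr : IsReduction m (reduce v i j) k l := by
    refine ⟨h'.left_lt, h'.right_lt, h'.ne, ?_, ?_⟩ <;>
      simp only [reduce_of_ne v j hik.symm, reduce_of_ne v j hil.symm]
    exacts [h'.ne_zero, h'.le]
  have hr' : IsReduction m (reduce v k l) i j := by
    refine ⟨h.left_lt, h.right_lt, h.ne, ?_, ?_⟩ <;>
      simp only [reduce_of_ne v l hik, reduce_of_ne v l hjk]
    exacts [h.ne_zero, h.le]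
  have hs : redSign (reduce v i j) k l = redSign v k l := by
    rw [redSign, redSign, reduce_of_ne v j hik.symm, reduce_of_ne v j hil.symm]
  have hs' : redSign (reduce v k l) i j = redSign v i j := by
    rw [redSign, redSign, reduce_of_ne v l hik, reduce_of_ne v l hjk]
  have hv : reduce (reduce v i j) k l = reduce (reduce v k l) i j := by
    unfold reduce at hs hs' ⊢
    rw [hs, hs']
    simp only [addRow, Function.update_of_ne hik, Function.update_of_ne hjk,
      Function.update_of_ne hik.symm, Function.update_of_ne hil.symm]
    exact Function.update_comm hik _ _ _
  rw [redValue, redValue, hN _ h.l1norm_reduce_lt k l hr, hN _ h'.l1norm_reduce_lt i j hr', hs, hs',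
    hv, smul_smul, smul_smul]
  rw [((hE.comm i j k l h.left_lt h.right_lt h'.left_lt h'.right_lt h.ne h'.ne hil
    hjk).zpow_zpow _ _).eq]

/-- The reductions `(i, j)` and `(j, l)` lead to a common vector, the second one after an intermediate
reduction `(i, l)`; the commutator relation `[E_ij, E_jl] = E_il` identifies the values. -/
theorem redValue_eq_of_chain (hE : SteinbergRel m E) (hc : IsBase m E c) {v : ℕ → ℤ}
    (hN : WellDefinedBelow m E c (l1norm m v)) {i j l : ℕ} (h : IsReduction m v i j)
    (h' : IsReduction m v j l) (hil : i ≠ l) :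
    redValue m E c v i j = redValue m E c v j l := by
  have hsg := h.redSign_eq
  have hsg' := h'.redSign_eq
  have hp := h.pos
  have hp' := h'.pos
  have hlt := h.l1norm_reduce_lt
  have hlt' := h'.l1norm_reduce_lt
  have hpos := h.l1norm_reduce_pos
  have hpos' := h'.l1norm_reduce_pos
  rw [redValue, redValue]
  unfold reduce at *
  generalize redSign v i j = ε at *
  generalize redSign v j l = δ at *
  have hεδ : ε * δ = 1 ∨ ε * δ = -1 := by
    rcases hsg with rfl | rfl <;> rcases hsg' with rfl | rfl <;> norm_num
  have hil' : IsReduction m v i l := ⟨h.left_lt, h'.right_lt, hil, h'.ne_zero, h'.le.trans h.le⟩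
  have hpil : 0 < ε * δ * (v i * v l) := by
    have : 0 < (ε * δ * (v i * v l)) * (v j * v j) := by nlinarith [mul_pos hp hp']
    exact lt_of_mul_lt_mul_right (by simpa using this) (mul_self_nonneg (v j))
  have a1 := natAbs_sub_of_pos hsg hp h.le
  have a2 := natAbs_sub_of_pos hsg' hp' h'.le
  have a3 := natAbs_sub_of_pos hεδ hpil hil'.le
  -- the common vector below both reductions
  set u3 := addRow (addRow v i j (-ε)) j l (-δ) with hu3
  set u4 := addRow (addRow v j l (-δ)) i l (-(ε * δ)) with hu4
  have hu34 : addRow u4 i j (-ε) = u3 := by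
    rw [hu3, hu4]
    funext k
    rcases eq_or_ne k i with rfl | hki
    · simp [addRow, h.ne, h.ne.symm, hil.symm, h'.ne.symm]
      ring
    rcases eq_or_ne k j with rfl | hkj
    · simp [addRow, hki, hil.symm]
    · simp [addRow, hki, hkj]
  have hn3 : l1norm m u3 < l1norm m v := by
    have := l1norm_addRow h'.left_lt (addRow v i j (-ε)) l (-δ)
    rw [addRow_of_ne _ _ _ h.ne.symm, addRow_of_ne _ _ _ hil.symm, ← hu3] at this
    omega
  have hn4 : l1norm m u4 < l1norm m v := by
    have := l1norm_addRow h.left_lt (addRow v j l (-δ)) l (-(ε * δ))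
    rw [addRow_of_ne _ _ _ h.ne, addRow_of_ne _ _ _ h'.ne.symm, ← hu4] at this
    omega
  have hp4 : 0 < l1norm m u4 := l1norm_pos.2 ⟨l, h'.right_lt, by
    rw [hu4, addRow_of_ne _ _ _ hil.symm, addRow_of_ne _ _ _ h'.ne.symm]; exact h'.ne_zero⟩
  have e1 := hN.smul_addRow hE hc h'.left_lt h'.right_lt h'.ne (ε := -δ) (by omega) hpos hlt hn3
  have e2 := hN.smul_addRow hE hc h.left_lt h'.right_lt hil (ε := -(ε * δ)) (by omega) hpos' hlt' hn4
  have e3 := hN.smul_addRow hE hc h.left_lt h.right_lt h.ne (ε := -ε) (v := u4) (by omega)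
    hp4 hn4 (hu34 ▸ hn3)
  rw [hu34] at e3
  rw [← hu3, zpow_neg, inv_smul_eq_iff] at e1
  rw [← hu4, zpow_neg, inv_smul_eq_iff] at e2
  rw [zpow_neg, inv_smul_eq_iff] at e3
  rw [e1, e2, e3, smul_smul, smul_smul, smul_smul,
    hE.zpow_mul_zpow h.left_lt h.right_lt h'.right_lt h.ne h'.ne hil]
  congr 2
  have c1 := (hE.comm i l j l h.left_lt h'.right_lt h.right_lt h'.right_lt hil h'.ne hil
    h'.ne.symm).zpow_zpow (ε * δ) δ
  rw [c1.eq]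

/-- If `|v i| = |v j|`, the reductions `(i, j)` and `(j, i)` differ by a Weyl element. -/
theorem redValue_eq_of_swap (hE : SteinbergRel m E) (hc : IsBase m E c) {v : ℕ → ℤ}
    (hN : WellDefinedBelow m E c (l1norm m v)) {i j : ℕ} (h : IsReduction m v i j)
    (h' : IsReduction m v j i) :
    redValue m E c v i j = redValue m E c v j i := by
  have hs : redSign v j i = redSign v i j := by rw [redSign, redSign, mul_comm]
  have hsg := h.redSign_eq
  have hp := h.pos
  have hlt := h.l1norm_reduce_lt
  have hlt' := h'.l1norm_reduce_lt
  have hpos := h.l1norm_reduce_pos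
  have hpos' := h'.l1norm_reduce_pos
  rw [redValue, redValue]
  unfold reduce at *
  rw [hs] at *
  generalize redSign v i j = ε at *
  have hε2 : ε * ε = 1 := by rcases hsg with rfl | rfl <;> norm_num
  have habs := natAbs_sub_of_pos hsg hp h.le
  have hle := h.le
  have hle' := h'.le
  have hvi : v i = ε * v j := by
    rcases hsg with rfl | rfl <;> omega
  have key := hN.weyl_smul_sign hE hc h.left_lt h.right_lt h.ne hsg hlt hpos
    (u := addRow v j i (-ε)) (by
      rw [addRow_of_ne _ _ _ h.ne, addRow_of_ne _ _ _ h.ne.symm, hvi]) (by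
      rw [addRow_self, addRow_self, hvi]
      linear_combination (-v j) * hε2) (fun k hki hkj => by
      rw [addRow_of_ne _ _ _ hki, addRow_of_ne _ _ _ hkj])
  have hfix := hN.smul_eq_self hE hc h.left_lt h.right_lt h.ne (addRow v j i (-ε)) hlt' hpos' (by
    rw [addRow_self, hvi]; linear_combination (-v j) * hε2)
  rw [← inv_smul_eq_iff, ← zpow_neg, smul_smul, ← zpow_smul_eq_self hfix (-ε), ← key, smul_smul]
  congr 1
  group

theorem redValue_eq (hE : SteinbergRel m E) (hc : IsBase m E c) {v : ℕ → ℤ}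
    (hN : WellDefinedBelow m E c (l1norm m v)) {i j k l : ℕ} (h : IsReduction m v i j)
    (h' : IsReduction m v k l) : redValue m E c v i j = redValue m E c v k l := by
  by_cases hjk : j = k
  · subst hjk
    by_cases hil : i = l
    · subst hil; exact redValue_eq_of_swap hE hc hN h h'
    · exact redValue_eq_of_chain hE hc hN h h' hil
  by_cases hil : i = l
  · subst hil
    exact (redValue_eq_of_chain hE hc hN h' h (Ne.symm hjk)).symm
  by_cases hik : i = k
  · subst hik
    by_cases hjl : j = l
    · rw [hjl]
    -- the smaller of the two subtracted entries reduces the larger one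
    have key : ∀ {j l : ℕ}, IsReduction m v i j → IsReduction m v i l → IsReduction m v j l →
        redValue m E c v i j = redValue m E c v i l := fun h h' h'' =>
      (redValue_eq_of_chain hE hc hN h h'' h'.ne).trans
        (redValue_eq_of_commute hE hN h'' h' h.ne.symm h''.ne h'.ne.symm)
    rcases isReduction_or h.right_lt h'.right_lt hjl h.ne_zero h'.ne_zero with h2 | h2
    · exact key h h' h2
    · exact (key h' h h2).symm
  · exact redValue_eq_of_commute hE hN h h' hik hil hjk

theorem wellDefinedBelow (hE : SteinbergRel m E) (hc : IsBase m E c) (N : ℕ) :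
    WellDefinedBelow m E c N := by
  induction N with
  | zero => exact fun v hv => absurd hv (Nat.not_lt_zero _)
  | succ N ih =>
    intro v hv i j h
    rcases (Nat.lt_succ_iff.1 hv).lt_or_eq with hlt | rfl
    · exact ih v hlt i j h
    have hex : ∃ p : ℕ × ℕ, IsReduction m v p.1 p.2 := ⟨(i, j), h⟩
    rw [cosetSection, dif_pos hex]
    exact redValue_eq hE hc ih hex.choose_spec h

end Peak
/-! ### The relations over indices in `ℕ` -/

section Relations

variable {P : Type} [Group P]

/-- The relations `R_{1,m}`, `R_{2,m}` and `R_{3,m}`, for a family `E` indexed by `ℕ × ℕ` instead of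
`Fin n × Fin n`. This allows the family of a subgroup to be the same function. -/
structure BlockRel (n m : ℕ) (T : P) (E : ℕ → ℕ → P) : Prop where
  T_mul_T : T * T = 1
  comm : ∀ i j k l, i < m → j < m → k < m → l < m → i ≠ j → k ≠ l → i ≠ l → j ≠ k →
    Commute (E i j) (E k l)
  mul : ∀ i j k, i < m → j < m → k < m → i ≠ j → j ≠ k → i ≠ k →
    E i j * E j k = E i k * E j k * E i j
  weyl_mul : 2 ≤ m → weyl E 0 1 * weyl E 1 0 = 1
  weyl_pow : 2 ≤ m → weyl E 0 1 ^ 4 = 1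
  T_comm : ∀ i j, i < m → j < m → i ≠ j → i ≠ 0 → j ≠ 0 → Commute T (E i j)
  T_inv : ∀ i j, i < m → j < m → i ≠ j → i = 0 ∨ j = 0 → T * E i j = (E i j)⁻¹ * T
  low_comm : ∀ i j k l, m ≤ i → i < n → j < m → m ≤ k → k < n → l < m →
    Commute (E i j) (E k l)
  act_comm : ∀ i j k l, i < m → j < m → m ≤ k → k < n → l < m → i ≠ j → i ≠ l →
    Commute (E i j) (E k l)
  act : ∀ i j k, i < m → j < m → m ≤ k → k < n → i ≠ j →
    E i j * E k i = (E k j)⁻¹ * E k i * E i j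
  T_low_comm : ∀ k l, m ≤ k → k < n → l < m → l ≠ 0 → Commute T (E k l)
  T_low_inv : ∀ k, m ≤ k → k < n → 0 < m → T * E k 0 = (E k 0)⁻¹ * T

/-- The generators `T` and `E_ij` with `i < n`, `j < m`, `i ≠ j`. -/
def generators (n m : ℕ) (T : P) (E : ℕ → ℕ → P) : Set P :=
  {x | x = T ∨ ∃ i j, i < n ∧ j < m ∧ i ≠ j ∧ x = E i j}

/-- `ρ` sends the generators to the matrices of the same names, acting on the first `n` coordinates of
sequences of integers and trivially on the others. -/
structure IsRepresentation (n m : ℕ) (T : P) (E : ℕ → ℕ → P)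
    (ρ : P →* Module.End ℤ (ℕ → ℤ)) : Prop where
  T : ∀ v, ρ T v = Function.update v 0 (-v 0)
  E : ∀ i j v, i < n → j < m → i ≠ j → ρ (E i j) v = addRow v i j 1

/-- The relations imply every relation between the matrices: if `T` and `E` satisfy `BlockRel n m` and
`ρ` represents them by their matrices, then `ρ` is faithful on the subgroup they generate. -/
def IsFaithfulPresentation (n m : ℕ) : Prop :=
  ∀ (P : Type) [Group P] (T : P) (E : ℕ → ℕ → P) (ρ : P →* Module.End ℤ (ℕ → ℤ)),
    BlockRel n m T E → IsRepresentation n m T E ρ →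
    ∀ g ∈ Subgroup.closure (generators n m T E), ρ g = 1 → g = 1

variable {n m : ℕ} {T : P} {E : ℕ → ℕ → P}

theorem T_mem : T ∈ Subgroup.closure (generators n m T E) :=
  Subgroup.subset_closure (Or.inl rfl)

theorem E_mem {i j : ℕ} (hi : i < n) (hj : j < m) (hij : i ≠ j) :
    E i j ∈ Subgroup.closure (generators n m T E) :=
  Subgroup.subset_closure (Or.inr ⟨i, j, hi, hj, hij, rfl⟩)

theorem weyl_mem {i j : ℕ} (hi : i < n) (hj : j < n) (hi' : i < m) (hj' : j < m) (hij : i ≠ j) :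
    weyl E i j ∈ Subgroup.closure (generators n m T E) :=
  mul_mem (mul_mem (E_mem hi hj' hij) (inv_mem (E_mem hj hi' hij.symm))) (E_mem hi hj' hij)

theorem BlockRel.steinbergRel (h : BlockRel n m T E) : SteinbergRel m E where
  comm := h.comm
  mul := h.mul
  weyl_mul i j hi hj hij := by
    by_cases hm : m ≤ 2
    · have h2 := h.weyl_mul (by omega)
      have : (i = 0 ∧ j = 1) ∨ (i = 1 ∧ j = 0) := by omega
      rcases this with ⟨rfl, rfl⟩ | ⟨rfl, rfl⟩
      · exact h2
      · exact mul_eq_one_iff_eq_inv.2 (eq_inv_of_mul_eq_one_right h2)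
    · obtain ⟨k, hk, hik, hjk⟩ : ∃ k < m, i ≠ k ∧ j ≠ k := by
        by_cases h0 : i ≠ 0 ∧ j ≠ 0
        · exact ⟨0, by omega, h0⟩
        by_cases h1 : i ≠ 1 ∧ j ≠ 1
        · exact ⟨1, by omega, h1⟩
        · exact ⟨2, by omega, by omega, by omega⟩
      exact weyl_mul_weyl_of_steinberg h.comm h.mul hi hj hk hij hik hjk

theorem BlockRel.isMonomial_T (h : BlockRel n m T E) :
    IsMonomial m E T 1 (fun k => if k = 0 then -1 else 1) where
  lt_iff k := Iff.rfl
  conj k l hk hl hkl := by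
    by_cases hk0 : k = 0
    · have hl0 : l ≠ 0 := fun e => hkl (hk0.trans e.symm)
      simpa [hk0, hl0] using h.T_inv k l hk hl hkl (Or.inl hk0)
    by_cases hl0 : l = 0
    · simpa [hk0, hl0] using h.T_inv k l hk hl hkl (Or.inr hl0)
    · simpa [hk0, hl0] using (h.T_comm k l hk hl hkl hk0 hl0).eq

theorem BlockRel.square (h : BlockRel n m T E) : BlockRel m m T E where
  __ := h
  low_comm _ _ _ _ h1 h2 := absurd h1 h2.not_ge
  act_comm _ _ _ _ _ _ h1 h2 := absurd h1 h2.not_ge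
  act _ _ _ _ _ h1 h2 := absurd h1 h2.not_ge
  T_low_comm _ _ h1 h2 := absurd h1 h2.not_ge
  T_low_inv _ h1 h2 := absurd h1 h2.not_ge

/-- The stabilizer of the last basis vector in `GL_{r+1}(ℤ)` is the group `G_r` of matrices of size
`r + 1`, and its relations are among those of `GL_{r+1}(ℤ)`. -/
theorem BlockRel.column {r : ℕ} (hr : 1 ≤ r) (h : BlockRel (r + 1) (r + 1) T E) :
    BlockRel (r + 1) r T E where
  T_mul_T := h.T_mul_T
  comm i j k l hi hj hk hl := h.comm i j k l (by omega) (by omega) (by omega) (by omega)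
  mul i j k hi hj hk := h.mul i j k (by omega) (by omega) (by omega)
  weyl_mul hm := h.weyl_mul (by omega)
  weyl_pow hm := h.weyl_pow (by omega)
  T_comm i j hi hj := h.T_comm i j (by omega) (by omega)
  T_inv i j hi hj := h.T_inv i j (by omega) (by omega)
  low_comm i j k l h1 h2 h3 h4 h5 h6 := h.comm i j k l (by omega) (by omega) (by omega) (by omega)
    (by omega) (by omega) (by omega) (by omega)
  act_comm i j k l h1 h2 h3 h4 h5 h6 h7 := h.comm i j k l (by omega) (by omega) (by omega)
    (by omega) h6 (by omega) h7 (by omega)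
  act i j k h1 h2 h3 h4 h5 := by
    have := h.mul k i j (by omega) (by omega) (by omega) (by omega) h5 (by omega)
    rw [mul_assoc, eq_inv_mul_iff_mul_eq, ← mul_assoc, this]
  T_low_comm k l h1 h2 h3 h4 := h.T_comm k l (by omega) (by omega) (by omega) (by omega) h4
  T_low_inv k h1 h2 h3 := h.T_inv k 0 (by omega) (by omega) (by omega) (Or.inr rfl)

end Relations

/-! ### The stabilizer of the last coordinate line -/

section Stabilizer

variable {P : Type} [Group P] {r : ℕ} {T : P} {E : ℕ → ℕ → P}

/-- An element standing for the sign change of the last coordinate `r`. -/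
def lastSign (r : ℕ) (T : P) (E : ℕ → ℕ → P) : P := weyl E 0 r * weyl E 0 r * T

/-- The subgroup generated by `T` and the `E_ij` with `j ≠ r`, which stand for matrices fixing the last
basis vector `e_r`. -/
def columnSubgroup (r : ℕ) (T : P) (E : ℕ → ℕ → P) : Subgroup P :=
  Subgroup.closure (generators (r + 1) r T E)

/-- The subgroup generated by `columnSubgroup` and the sign change of the last coordinate. It plays the
role of the stabilizer of the line spanned by `e_r`. -/
def lineSubgroup (r : ℕ) (T : P) (E : ℕ → ℕ → P) : Subgroup P :=
  Subgroup.closure (insert (lastSign r T E) (columnSubgroup r T E : Set P))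

theorem columnSubgroup_le : columnSubgroup r T E ≤ lineSubgroup r T E := fun _ hx =>
  Subgroup.subset_closure (Or.inr hx)

theorem lastSign_mem : lastSign r T E ∈ lineSubgroup r T E := Subgroup.subset_closure (Or.inl rfl)

theorem T_mul_weyl (h : BlockRel (r + 1) (r + 1) T E) (hr : 1 ≤ r) :
    T * weyl E 0 r = (weyl E 0 r)⁻¹ * T := by
  have := h.isMonomial_T.weyl (k := 0) (l := r) (by omega) (by omega) (by omega)
  simpa [show r ≠ 0 by omega] using this

theorem weyl_pow_four (h : BlockRel (r + 1) (r + 1) T E) (hr : 1 ≤ r) :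
    weyl E 0 r ^ 4 = 1 := by
  have h4 := h.weyl_pow (by omega)
  by_cases hr1 : r = 1
  · rwa [hr1]
  have hm := h.steinbergRel.isMonomial_weyl (i := 1) (j := r) (by omega) (by omega) (by omega)
  have hs : SemiconjBy _ _ _ := hm.weyl (k := 0) (l := 1) (by omega) (by omega) (by omega)
  have := hs.pow_right 4
  rw [h4, Equiv.swap_apply_left, Equiv.swap_apply_of_ne_of_ne (by omega) (by omega)] at this
  have := this.eq
  simpa using this

theorem lastSign_mul_flip (h : BlockRel (r + 1) (r + 1) T E) (hr : 1 ≤ r) :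
    lastSign r T E * lastSign r T E = 1 := by
  have h1 := T_mul_weyl h hr
  have h2 := h.T_mul_T
  rw [lastSign]
  calc weyl E 0 r * weyl E 0 r * T * (weyl E 0 r * weyl E 0 r * T)
      = weyl E 0 r * weyl E 0 r * (T * weyl E 0 r) * weyl E 0 r * T := by group
    _ = weyl E 0 r * weyl E 0 r * ((weyl E 0 r)⁻¹ * T) * weyl E 0 r * T := by rw [h1]
    _ = weyl E 0 r * (T * weyl E 0 r) * T := by group
    _ = 1 := by rw [h1, mul_inv_cancel_left, h2]

theorem lastSign_mul_T (h : BlockRel (r + 1) (r + 1) T E) (hr : 1 ≤ r) :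
    lastSign r T E * T = T * lastSign r T E := by
  have h1 := T_mul_weyl h hr
  have h2 := h.T_mul_T
  have h4 := weyl_pow_four h hr
  have h5 : weyl E 0 r * weyl E 0 r = (weyl E 0 r)⁻¹ * (weyl E 0 r)⁻¹ := by
    rw [eq_inv_mul_iff_mul_eq, eq_inv_iff_mul_eq_one]
    simpa [pow_succ, mul_assoc] using h4
  rw [lastSign, mul_assoc _ T T, h2, mul_one]
  calc weyl E 0 r * weyl E 0 r = (weyl E 0 r)⁻¹ * (weyl E 0 r)⁻¹ * (T * T) := by
        rw [h2, mul_one, h5]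
    _ = (weyl E 0 r)⁻¹ * ((weyl E 0 r)⁻¹ * T) * T := by group
    _ = (weyl E 0 r)⁻¹ * (T * weyl E 0 r) * T := by rw [h1]
    _ = (weyl E 0 r)⁻¹ * T * weyl E 0 r * T := by group
    _ = T * weyl E 0 r * weyl E 0 r * T := by rw [h1]
    _ = T * (weyl E 0 r * weyl E 0 r * T) := by group

theorem lastSign_conj_mem (h : BlockRel (r + 1) (r + 1) T E) (hr : 1 ≤ r) {x : P}
    (hx : x ∈ columnSubgroup r T E) :
    lastSign r T E * x * (lastSign r T E)⁻¹ ∈ columnSubgroup r T E := by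
  suffices columnSubgroup r T E ≤
      (columnSubgroup r T E).comap (MulAut.conj (lastSign r T E)).toMonoidHom from this hx
  refine (Subgroup.closure_le _).2 ?_
  rintro x (rfl | ⟨i, j, hi, hj, hij, rfl⟩)
  · show lastSign r x E * x * (lastSign r x E)⁻¹ ∈ columnSubgroup r x E
    rw [lastSign_mul_T h hr, mul_inv_cancel_right]
    exact T_mem
  · show lastSign r T E * E i j * (lastSign r T E)⁻¹ ∈ columnSubgroup r T E
    have hmw := h.steinbergRel.isMonomial_weyl (i := 0) (j := r) (by omega) (by omega) (by omega)
    have s1 := h.isMonomial_T.conj i j hi (by omega) hij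
    have s2 := hmw.zpow hi (by omega) hij
    have s3 := hmw.zpow ((hmw.lt_iff i).2 hi) ((hmw.lt_iff j).2 (by omega))
      (fun e => hij ((Equiv.swap 0 r).injective e))
    simp only [Equiv.swap_apply_self, Equiv.Perm.one_apply] at s1 s3
    rw [lastSign, mul_assoc _ T, s1, ← mul_assoc, mul_assoc (weyl E 0 r), s2, ← mul_assoc, s3,
      mul_assoc (E i j ^ _), mul_assoc (E i j ^ _), mul_inv_cancel_right]
    exact zpow_mem (E_mem hi hj hij) _

/-- `columnSubgroup` has index at most two in `lineSubgroup`. -/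
theorem mem_columnSubgroup_or (h : BlockRel (r + 1) (r + 1) T E) (hr : 1 ≤ r) {x : P}
    (hx : x ∈ lineSubgroup r T E) :
    x ∈ columnSubgroup r T E ∨ lastSign r T E * x ∈ columnSubgroup r T E := by
  have ht := lastSign_mul_flip h hr
  have ht' : (lastSign r T E)⁻¹ = lastSign r T E := inv_eq_of_mul_eq_one_left ht
  have main : ∀ s ∈ insert (lastSign r T E) (columnSubgroup r T E : Set P), ∀ y,
      (y ∈ columnSubgroup r T E ∨ lastSign r T E * y ∈ columnSubgroup r T E) →
      (s * y ∈ columnSubgroup r T E ∨ lastSign r T E * (s * y) ∈ columnSubgroup r T E) := by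
    rintro s (rfl | hs) y (hy | hy)
    · right; rwa [← mul_assoc, ht, one_mul]
    · left; exact hy
    · left; exact mul_mem hs hy
    · right
      have := mul_mem (lastSign_conj_mem h hr hs) hy
      rwa [mul_assoc, inv_mul_cancel_left, mul_assoc] at this
  induction hx using Subgroup.closure_induction_left with
  | one => exact Or.inl (one_mem _)
  | mul_left s hs y _ ih => exact main s hs y ih
  | inv_mul_cancel s hs y _ ih =>
    refine main _ ?_ y ih
    rcases hs with rfl | hs
    · rw [ht']; exact Or.inl rfl
    · exact Or.inr (inv_mem hs)

/-- The coset that stands for the line spanned by `e_k`. -/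
def baseCoset (r : ℕ) (T : P) (E : ℕ → ℕ → P) (k : ℕ) : P ⧸ lineSubgroup r T E :=
  if k = r then ((1 : P) : P ⧸ lineSubgroup r T E) else (weyl E k r : P)

theorem weyl_zpow_mem {i j : ℕ} (hi : i < r) (hj : j < r)
    (hij : i ≠ j) (a : ℤ) : weyl E i j ^ a ∈ lineSubgroup r T E :=
  columnSubgroup_le (zpow_mem (weyl_mem (by omega) (by omega) hi hj hij) a)

theorem weyl_mul_self_mem (h : BlockRel (r + 1) (r + 1) T E) {k : ℕ} (hk : k < r) :
    weyl E k r * weyl E k r ∈ lineSubgroup r T E := by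
  have h0 : weyl E 0 r * weyl E 0 r ∈ lineSubgroup r T E := by
    have := mul_mem (lastSign_mem (r := r) (T := T) (E := E)) (columnSubgroup_le T_mem)
    rwa [lastSign, mul_assoc _ T T, h.T_mul_T, mul_one] at this
  by_cases hk0 : k = 0
  · rwa [hk0]
  have hm := h.steinbergRel.isMonomial_weyl (i := k) (j := 0) (by omega) (by omega) (by omega)
  have hs := hm.weyl (k := 0) (l := r) (by omega) (by omega) (by omega)
  rw [Equiv.swap_apply_right, Equiv.swap_apply_of_ne_of_ne (by omega) (by omega)] at hs
  have hs' := eq_mul_inv_of_mul_eq hs.symm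
  have hwm := weyl_zpow_mem (T := T) (E := E) hk (show 0 < r by omega) hk0 1
  rw [zpow_one] at hwm
  have := mul_mem (mul_mem hwm h0) (inv_mem hwm)
  have e : weyl E k 0 * (weyl E 0 r * weyl E 0 r) * (weyl E k 0)⁻¹ =
      (weyl E k 0 * weyl E 0 r * (weyl E k 0)⁻¹) * (weyl E k 0 * weyl E 0 r * (weyl E k 0)⁻¹) := by
    group
  rw [e, ← hs'] at this
  generalize (if 0 = k then (-1 : ℤˣ) else 1) * (if r = k then -1 else 1) = ε at this
  rcases Int.units_eq_one_or ε with rfl | rfl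
  · simpa using this
  · simpa using inv_mem this

theorem mk_weyl_zpow (h : BlockRel (r + 1) (r + 1) T E) {k : ℕ} (hk : k < r) (ε : ℤˣ) {x : P}
    (hx : x ∈ lineSubgroup r T E) :
    ((weyl E k r ^ (ε : ℤ) * x : P) : P ⧸ lineSubgroup r T E) = baseCoset r T E k := by
  rw [QuotientGroup.mk_mul_of_mem _ hx, baseCoset, if_neg hk.ne]
  rcases Int.units_eq_one_or ε with rfl | rfl
  · simp
  · rw [QuotientGroup.eq]
    simpa using weyl_mul_self_mem h hk

theorem smul_baseCoset (h : BlockRel (r + 1) (r + 1) T E) {g : P} (hg : g ∈ lineSubgroup r T E)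
    {σ : Equiv.Perm ℕ} {χ : ℕ → ℤˣ} (hm : IsMonomial (r + 1) E g σ χ) (hσ : σ r = r) {k : ℕ}
    (hk : k < r + 1) : g • baseCoset r T E k = baseCoset r T E (σ k) := by
  by_cases hkr : k = r
  · subst hkr
    rw [hσ, baseCoset, if_pos rfl, MulAction.Quotient.smul_coe, smul_eq_mul, QuotientGroup.eq,
      mul_one, mul_one]
    exact inv_mem hg
  · have hkr' : k < r := by omega
    have hσk : σ k < r := by
      have := (hm.lt_iff k).2 hk
      have : σ k ≠ r := fun e => hkr (σ.injective (e.trans hσ.symm))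
      omega
    conv_lhs => rw [baseCoset, if_neg hkr]
    rw [MulAction.Quotient.smul_coe, smul_eq_mul, hm.weyl hk (by omega) hkr, hσ]
    exact mk_weyl_zpow h hσk _ hg

theorem isBase_baseCoset (h : BlockRel (r + 1) (r + 1) T E) :
    IsBase (r + 1) E (baseCoset r T E) := by
  have hS := h.steinbergRel
  have key : ∀ i k, i < r → k < r + 1 →
      weyl E i r • baseCoset r T E k = baseCoset r T E (Equiv.swap i r k) := by
    intro i k hi hk
    by_cases hkr : k = r
    · subst hkr
      rw [Equiv.swap_apply_right, baseCoset, baseCoset, if_pos rfl, if_neg hi.ne,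
        MulAction.Quotient.smul_coe, smul_eq_mul, mul_one]
    by_cases hki : k = i
    · subst hki
      rw [Equiv.swap_apply_left, baseCoset, baseCoset, if_pos rfl, if_neg hkr,
        MulAction.Quotient.smul_coe, smul_eq_mul, QuotientGroup.eq, mul_one]
      exact inv_mem (weyl_mul_self_mem h hi)
    · rw [Equiv.swap_apply_of_ne_of_ne hki hkr]
      conv_lhs => rw [baseCoset, if_neg hkr]
      rw [MulAction.Quotient.smul_coe, smul_eq_mul]
      have hw := (hS.isMonomial_weyl (i := r) (j := k) (by omega) hk (by omega)).weyl
        (k := i) (l := r) (by omega) (by omega) (by omega)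
      rw [Equiv.swap_apply_left, Equiv.swap_apply_of_ne_of_ne hi.ne (Ne.symm hki)] at hw
      have hinv := hS.weyl_eq_inv (i := r) (j := k) (by omega) hk (by omega)
      rw [hinv, inv_mul_eq_iff_eq_mul, ← mul_assoc, eq_mul_inv_iff_mul_eq] at hw
      rw [hw]
      have := mk_weyl_zpow h (show k < r by omega) 1
        (weyl_zpow_mem hi (show k < r by omega) (Ne.symm hki)
          (((if i = r then (-1 : ℤˣ) else 1) * (if r = r then -1 else 1) : ℤˣ) : ℤ))
      rw [Units.val_one, zpow_one] at this
      exact this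
  refine ⟨fun k l j hk hl hj hkl hlj => ?_, fun i j k hi hj hk hij => ?_⟩
  · by_cases hjr : j = r
    · subst hjr
      rw [baseCoset, if_pos rfl, MulAction.Quotient.smul_coe, smul_eq_mul, QuotientGroup.eq,
        mul_one, mul_one]
      exact inv_mem (columnSubgroup_le (E_mem hk (by omega) hkl))
    · conv_lhs => rw [baseCoset, if_neg hjr]
      rw [MulAction.Quotient.smul_coe, smul_eq_mul]
      have hw := (hS.isMonomial_weyl (i := r) (j := j) (by omega) hj (by omega))
      have hc := hw.conj k l hk hl hkl
      have hinv := hS.weyl_eq_inv (i := r) (j := j) (by omega) hj (by omega)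
      have hlt := (hw.lt_iff l).2 hl
      have hne : Equiv.swap r j l ≠ r := by
        rw [Ne, Equiv.swap_apply_eq_iff, Equiv.swap_apply_left]; exact hlj
      conv at hc => rw [hinv, inv_mul_eq_iff_eq_mul, ← mul_assoc, eq_mul_inv_iff_mul_eq]
      rw [hc]
      have := mk_weyl_zpow h (show j < r by omega) 1 (columnSubgroup_le (zpow_mem
        (E_mem (T := T) (E := E) (m := r) ((hw.lt_iff k).2 hk) (by omega)
          (fun e => hkl ((Equiv.swap r j).injective e)))
        (((if k = r then (-1 : ℤˣ) else 1) * (if l = r then -1 else 1) : ℤˣ) : ℤ)))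
      rw [Units.val_one, zpow_one] at this
      exact this
  · by_cases hjr : j = r
    · subst hjr
      exact key i k (by omega) hk
    by_cases hir : i = r
    · subst hir
      rw [hS.weyl_eq_inv hi hj hij, inv_smul_eq_iff, key j _ (by omega), Equiv.swap_comm,
        Equiv.swap_apply_self]
      exact ((hS.isMonomial_weyl hi hj hij).lt_iff k).2 hk
    · refine smul_baseCoset h ?_ (hS.isMonomial_weyl hi hj hij)
        (Equiv.swap_apply_of_ne_of_ne (Ne.symm hir) (Ne.symm hjr)) hk
      have := weyl_zpow_mem (r := r) (T := T) (E := E) (i := i) (j := j) (by omega) (by omega) hij 1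
      rwa [zpow_one] at this

end Stabilizer
/-! ### Faithfulness on the presented group -/

section Representation

variable {P : Type} [Group P] {n m r : ℕ} {T : P} {E : ℕ → ℕ → P} {ρ : P →* Module.End ℤ (ℕ → ℤ)}

theorem apply_inv_of_apply {g : P} {u v : ℕ → ℤ} (h : ρ g u = v) : ρ g⁻¹ v = u := by
  rw [← h, ← Module.End.mul_apply, ← map_mul, inv_mul_cancel, map_one, Module.End.one_apply]

theorem IsRepresentation.E_zpow (hρ : IsRepresentation n m T E ρ) {i j : ℕ} (hi : i < n)
    (hj : j < m) (hij : i ≠ j) (a : ℤ) (v : ℕ → ℤ) : ρ (E i j ^ a) v = addRow v i j a := by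
  induction a using Int.induction_on generalizing v with
  | zero => simp [addRow_zero]
  | succ a ih =>
    rw [zpow_add_one, map_mul, Module.End.mul_apply, hρ.E i j v hi hj hij, ih,
      addRow_addRow_same v hij, add_comm]
  | pred a ih =>
    rw [sub_eq_add_neg, zpow_add, map_mul, Module.End.mul_apply, zpow_neg_one,
      apply_inv_of_apply (u := addRow v i j (-1)), ih, addRow_addRow_same v hij, add_comm]
    rw [hρ.E i j _ hi hj hij, addRow_addRow_same v hij, neg_add_cancel, addRow_zero]

theorem IsRepresentation.weyl_apply (hρ : IsRepresentation n m T E ρ) {i j : ℕ} (hi : i < n)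
    (hj : j < n) (hi' : i < m) (hj' : j < m) (hij : i ≠ j) (v : ℕ → ℤ) :
    ρ (weyl E i j) v i = v j ∧ ρ (weyl E i j) v j = -v i := by
  have h := hρ.E_zpow hj hi' hij.symm (-1)
  rw [zpow_neg_one] at h
  rw [weyl, map_mul, map_mul, Module.End.mul_apply, Module.End.mul_apply, hρ.E i j _ hi hj' hij, h,
    hρ.E i j _ hi hj' hij]
  simp [addRow, hij, hij.symm]

theorem apply_single_of_mem_columnSubgroup (hr : 1 ≤ r)
    (hρ : IsRepresentation (r + 1) (r + 1) T E ρ) {g : P} (hg : g ∈ columnSubgroup r T E) :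
    ρ g (Pi.single r 1) = Pi.single r 1 := by
  have hgen : ∀ x ∈ generators (r + 1) r T E, ρ x (Pi.single r 1) = Pi.single r 1 := by
    rintro x (rfl | ⟨i, j, hi, hj, hij, rfl⟩)
    · rw [hρ.T]; simp [show r ≠ 0 by omega]
    · rw [hρ.E i j _ hi (by omega) hij, addRow]
      simp [show r ≠ j by omega, Function.update_eq_self]
  induction hg using Subgroup.closure_induction_left with
  | one => simp
  | mul_left x hx y _ ih => rw [map_mul, Module.End.mul_apply, ih, hgen x hx]
  | inv_mul_cancel x hx y _ ih =>
    rw [map_mul, Module.End.mul_apply, ih, apply_inv_of_apply (hgen x hx)]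

theorem l1norm_addRow_pos {i j : ℕ} (hj : j < m) (hij : i ≠ j) (a : ℤ) {v : ℕ → ℤ}
    (hv : 0 < l1norm m v) : 0 < l1norm m (addRow v i j a) := by
  obtain ⟨k, hk, hvk⟩ := l1norm_pos.1 hv
  by_cases hj0 : v j = 0
  · rw [addRow, hj0, mul_zero, add_zero, Function.update_eq_self]; exact hv
  · exact l1norm_pos.2 ⟨j, hj, by rwa [addRow_of_ne _ _ _ hij.symm]⟩

/-- An element whose matrix fixes `e_r` lies in `lineSubgroup`: by equivariance of `cosetSection` it
fixes the coset attached to `e_r`. -/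
theorem mem_lineSubgroup (h : BlockRel (r + 1) (r + 1) T E)
    (hρ : IsRepresentation (r + 1) (r + 1) T E ρ) {g : P}
    (hg : g ∈ Subgroup.closure (generators (r + 1) (r + 1) T E))
    (hfix : ρ g (Pi.single r 1) = Pi.single r 1) : g ∈ lineSubgroup r T E := by
  have hS := h.steinbergRel
  have hb := isBase_baseCoset h
  set s := cosetSection (r + 1) E (baseCoset r T E) with hs
  have hE : ∀ i j, i < r + 1 → j < r + 1 → i ≠ j → ∀ ε : ℤ, ε = 1 ∨ ε = -1 → ∀ v,
      0 < l1norm (r + 1) v → E i j ^ ε • s v = s (addRow v i j ε) := fun i j hi hj hij ε hε v hv =>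
    (wellDefinedBelow hS hb
      (l1norm (r + 1) v + l1norm (r + 1) (addRow v i j ε) + 1)).smul_addRow hS hb hi hj hij hε hv
      (by omega) (by omega)
  have hT : ∀ v, 0 < l1norm (r + 1) v → 0 < l1norm (r + 1) (Function.update v 0 (-v 0)) ∧
      T • s v = s (Function.update v 0 (-v 0)) := by
    intro v hv
    have := (wellDefinedBelow hS hb (l1norm (r + 1) v + 1)).smul_monomial h.isMonomial_T
      (fun k hk => smul_baseCoset h (columnSubgroup_le T_mem) h.isMonomial_T rfl hk) v
      (Function.update v 0 (-v 0)) (by omega) hv (fun k => by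
        by_cases hk : k = 0
        · subst hk; simp
        · simp [hk])
    exact ⟨this.1 ▸ hv, this.2⟩
  have hTinv : T⁻¹ = T := inv_eq_of_mul_eq_one_left h.T_mul_T
  have hTstep : ∀ y : P, (0 < l1norm (r + 1) (ρ y (Pi.single r 1)) ∧
      s (ρ y (Pi.single r 1)) = y • baseCoset r T E r) →
      (0 < l1norm (r + 1) (ρ (T * y) (Pi.single r 1)) ∧
      s (ρ (T * y) (Pi.single r 1)) = (T * y) • baseCoset r T E r) := by
    intro y ⟨h1, h2⟩
    rw [map_mul, Module.End.mul_apply, hρ.T, mul_smul, ← h2]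
    exact ⟨(hT _ h1).1, (hT _ h1).2.symm⟩
  have hEstep : ∀ i j, i < r + 1 → j < r + 1 → i ≠ j → ∀ ε : ℤ, ε = 1 ∨ ε = -1 → ∀ y : P,
      (0 < l1norm (r + 1) (ρ y (Pi.single r 1)) ∧
      s (ρ y (Pi.single r 1)) = y • baseCoset r T E r) →
      (0 < l1norm (r + 1) (ρ (E i j ^ ε * y) (Pi.single r 1)) ∧
      s (ρ (E i j ^ ε * y) (Pi.single r 1)) = (E i j ^ ε * y) • baseCoset r T E r) := by
    intro i j hi hj hij ε hε y ⟨h1, h2⟩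
    rw [map_mul, Module.End.mul_apply, hρ.E_zpow hi hj hij, mul_smul, ← h2]
    exact ⟨l1norm_addRow_pos hj hij _ h1, (hE i j hi hj hij ε hε _ h1).symm⟩
  have hbase : 0 < l1norm (r + 1) (Pi.single r 1) ∧ s (Pi.single r 1) = baseCoset r T E r := by
    refine ⟨l1norm_pos.2 ⟨r, by omega, by simp⟩, cosetSection_of_not_isReduction
      (fun i j hij => hij.ne ?_) (by omega) (by simp)⟩
    have h1 := hij.ne_zero
    have h2 := hij.left_ne_zero
    simp only [ne_eq, Pi.single_apply, ite_eq_right_iff, one_ne_zero, imp_false, not_not] at h1 h2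
    rw [h1, h2]
  have main : 0 < l1norm (r + 1) (ρ g (Pi.single r 1)) ∧
      s (ρ g (Pi.single r 1)) = g • baseCoset r T E r := by
    clear hfix
    induction hg using Subgroup.closure_induction_left with
    | one => simpa using hbase
    | mul_left x hx y _ ih =>
      rcases hx with rfl | ⟨i, j, hi, hj, hij, rfl⟩
      · exact hTstep y ih
      · simpa using hEstep i j hi hj hij 1 (Or.inl rfl) y ih
    | inv_mul_cancel x hx y _ ih =>
      rcases hx with rfl | ⟨i, j, hi, hj, hij, rfl⟩
      · rw [hTinv]; exact hTstep y ih
      · simpa using hEstep i j hi hj hij (-1) (Or.inr rfl) y ih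
  have h2 := main.2
  rw [hfix, hbase.2, baseCoset, if_pos rfl, MulAction.Quotient.smul_coe, smul_eq_mul,
    QuotientGroup.eq, mul_one, inv_one, one_mul] at h2
  exact h2

/-- Faithfulness for `GL_{r+1}(ℤ)` follows from faithfulness for the stabilizer of `e_r`. -/
theorem isFaithfulPresentation_square (hr : 1 ≤ r) (hcol : IsFaithfulPresentation (r + 1) r) :
    IsFaithfulPresentation (r + 1) (r + 1) := by
  intro P _ T E ρ h hρ g hg h1
  have hline := mem_lineSubgroup h hρ hg (by rw [h1, Module.End.one_apply])
  have hmem : g ∈ columnSubgroup r T E := by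
    refine (mem_columnSubgroup_or h hr hline).resolve_right fun hflip => ?_
    have h2 := apply_single_of_mem_columnSubgroup hr hρ hflip
    rw [map_mul, h1, mul_one, lastSign, map_mul, map_mul, Module.End.mul_apply, Module.End.mul_apply,
      apply_single_of_mem_columnSubgroup hr hρ T_mem] at h2
    have h3 := congrFun h2 r
    have hw := hρ.weyl_apply (i := 0) (j := r) (by omega) (by omega) (by omega) (by omega)
      (by omega)
    rw [(hw _).2, (hw _).1] at h3
    simp at h3
  exact hcol P T E ρ (h.column hr) ⟨hρ.T, fun i j v hi hj => hρ.E i j v hi (by omega)⟩ g hmem h1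

/-- The subgroup generated by the `E_kl` with `(k, l)` in `s`. -/
def lowSubgroup (E : ℕ → ℕ → P) (s : Finset (ℕ × ℕ)) : Subgroup P :=
  Subgroup.closure ((fun p => E p.1 p.2) '' (s : Set (ℕ × ℕ)))

theorem mem_lowSubgroup {s : Finset (ℕ × ℕ)} {k l : ℕ} (h : (k, l) ∈ s) :
    E k l ∈ lowSubgroup E s := Subgroup.subset_closure ⟨(k, l), h, rfl⟩

/-- Elements of `lowSubgroup E s` fix the first `m` coordinates, and change the coordinate `k` only if
`v` has a nonzero entry `l` with `(k, l) ∈ s`. -/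
theorem apply_of_mem_lowSubgroup (hρ : IsRepresentation n m T E ρ) {s : Finset (ℕ × ℕ)}
    (hs : ∀ p ∈ s, m ≤ p.1 ∧ p.1 < n ∧ p.2 < m) {g : P} (hg : g ∈ lowSubgroup E s) (v : ℕ → ℤ) :
    (∀ j < m, ρ g v j = v j) ∧
      ∀ k, (∀ l < m, v l ≠ 0 → (k, l) ∉ s) → ρ g v k = v k := by
  have step : ∀ p ∈ s, ∀ a : ℤ, ∀ u : ℕ → ℤ, ((∀ j < m, u j = v j) ∧
      ∀ k, (∀ l < m, v l ≠ 0 → (k, l) ∉ s) → u k = v k) →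
      ((∀ j < m, ρ (E p.1 p.2 ^ a) u j = v j) ∧
      ∀ k, (∀ l < m, v l ≠ 0 → (k, l) ∉ s) → ρ (E p.1 p.2 ^ a) u k = v k) := by
    rintro ⟨k, l⟩ hp a u ⟨h1, h2⟩
    obtain ⟨hk, hk', hl⟩ := hs _ hp
    simp only at hk hk' hl ⊢
    rw [hρ.E_zpow hk' hl (by omega)]
    refine ⟨fun j hj => ?_, fun k' hk'' => ?_⟩
    · rw [addRow_of_ne _ _ _ (by omega), h1 j hj]
    · by_cases hkk : k' = k
      · subst hkk
        have : v l = 0 := by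
          by_contra hne
          exact hk'' l hl hne hp
        rw [addRow_self, h1 l hl, this, mul_zero, add_zero, h2 k' hk'']
      · rw [addRow_of_ne _ _ _ hkk, h2 k' hk'']
  induction hg using Subgroup.closure_induction_left with
  | one => simp
  | mul_left x hx y _ ih =>
    obtain ⟨p, hp, rfl⟩ := hx
    have := step p hp 1 _ ih
    rw [zpow_one] at this
    simpa only [map_mul, Module.End.mul_apply] using this
  | inv_mul_cancel x hx y _ ih =>
    obtain ⟨p, hp, rfl⟩ := hx
    have := step p hp (-1) _ ih
    rw [zpow_neg_one] at this
    simpa only [map_mul, Module.End.mul_apply] using this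

theorem exists_zpow_mul_of_mem_closure_insert {x : P} {S : Set P} (h : ∀ y ∈ S, Commute x y) {g : P}
    (hg : g ∈ Subgroup.closure (insert x S)) :
    ∃ a : ℤ, ∃ y ∈ Subgroup.closure S, g = x ^ a * y := by
  induction hg using Subgroup.closure_induction_left with
  | one => exact ⟨0, 1, one_mem _, by simp⟩
  | mul_left s hs y _ ih =>
    obtain ⟨a, z, hz, rfl⟩ := ih
    rcases hs with rfl | hs
    · exact ⟨1 + a, z, hz, by rw [← mul_assoc, zpow_add, zpow_one]⟩
    · exact ⟨a, s * z, mul_mem (Subgroup.subset_closure hs) hz, by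
        rw [← mul_assoc, ← mul_assoc, ((h s hs).zpow_left a).eq]⟩
  | inv_mul_cancel s hs y _ ih =>
    obtain ⟨a, z, hz, rfl⟩ := ih
    rcases hs with rfl | hs
    · exact ⟨-1 + a, z, hz, by rw [← mul_assoc, zpow_add, zpow_neg_one]⟩
    · exact ⟨a, s⁻¹ * z, mul_mem (inv_mem (Subgroup.subset_closure hs)) hz, by
        rw [← mul_assoc, ← mul_assoc, ((h s hs).zpow_left a).inv_right.eq]⟩

theorem eq_one_of_mem_lowSubgroup (h : BlockRel n m T E) (hρ : IsRepresentation n m T E ρ)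
    (s : Finset (ℕ × ℕ)) (hs : ∀ p ∈ s, m ≤ p.1 ∧ p.1 < n ∧ p.2 < m) :
    ∀ g ∈ lowSubgroup E s, ρ g = 1 → g = 1 := by
  induction s using Finset.induction_on with
  | empty => intro g hg _; simpa [lowSubgroup] using hg
  | insert p s hp ih =>
    intro g hg h1
    have hs' : ∀ q ∈ s, m ≤ q.1 ∧ q.1 < n ∧ q.2 < m := fun q hq => hs q (Finset.mem_insert_of_mem hq)
    obtain ⟨k, l⟩ := p
    obtain ⟨hk, hk', hl⟩ := hs _ (Finset.mem_insert_self _ _)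
    simp only at hk hk' hl
    rw [lowSubgroup, Finset.coe_insert, Set.image_insert_eq] at hg
    obtain ⟨a, y, hy, rfl⟩ := exists_zpow_mul_of_mem_closure_insert (by
      rintro _ ⟨q, hq, rfl⟩
      obtain ⟨hq1, hq2, hq3⟩ := hs' q hq
      exact h.low_comm _ _ _ _ hk hk' hl hq1 hq2 hq3) hg
    have hy' := apply_of_mem_lowSubgroup hρ hs' hy (Pi.single l 1)
    have h2 := congrFun (LinearMap.congr_fun h1 (Pi.single l 1)) k
    have hkl : k ≠ l := by omega
    rw [map_mul, Module.End.mul_apply, hρ.E_zpow hk' hl hkl, addRow_self,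
      hy'.1 l hl, hy'.2 k (fun l' _ hne => by
        rw [Pi.single_apply] at hne
        have : l' = l := by by_contra hc; simp [hc] at hne
        rwa [this])] at h2
    simp [hkl] at h2
    subst h2
    rw [zpow_zero, one_mul] at h1 ⊢
    exact ih hs' y hy h1

theorem apply_of_mem_square (hm : 1 ≤ m) (hmn : m ≤ n) (hρ : IsRepresentation n m T E ρ) {g : P}
    (hg : g ∈ Subgroup.closure (generators m m T E)) (v : ℕ → ℤ) {k : ℕ} (hk : m ≤ k) :
    ρ g v k = v k := by
  have hgen : ∀ x ∈ generators m m T E, ∀ v, ρ x v k = v k ∧ ρ x⁻¹ v k = v k := by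
    rintro x (rfl | ⟨i, j, hi, hj, hij, rfl⟩) v
    · have hinv : ρ x⁻¹ v = Function.update v 0 (-v 0) := apply_inv_of_apply (by
        rw [hρ.T]; simp)
      rw [hρ.T, hinv, Function.update_of_ne (by omega)]
      exact ⟨rfl, rfl⟩
    · have hinv := hρ.E_zpow (hi.trans_le hmn) hj hij (-1) v
      rw [zpow_neg_one] at hinv
      rw [hρ.E _ _ _ (hi.trans_le hmn) hj hij, hinv, addRow_of_ne _ _ _ (by omega),
        addRow_of_ne _ _ _ (by omega)]
      exact ⟨rfl, rfl⟩
  induction hg using Subgroup.closure_induction_left with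
  | one => simp
  | mul_left x hx y _ ih => rw [map_mul, Module.End.mul_apply, (hgen x hx _).1, ih]
  | inv_mul_cancel x hx y _ ih => rw [map_mul, Module.End.mul_apply, (hgen x hx _).2, ih]

theorem conj_mem_lowSubgroup {s : Finset (ℕ × ℕ)} {x g : P}
    (h : ∀ p ∈ s, x * E p.1 p.2 * x⁻¹ ∈ lowSubgroup E s) (hg : g ∈ lowSubgroup E s) :
    x * g * x⁻¹ ∈ lowSubgroup E s := by
  suffices lowSubgroup E s ≤ (lowSubgroup E s).comap (MulAut.conj x).toMonoidHom from this hg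
  refine (Subgroup.closure_le _).2 ?_
  rintro _ ⟨p, hp, rfl⟩
  exact h p hp

theorem exists_eq_mul_of_mem_closure (h : BlockRel n m T E) {g : P}
    (hg : g ∈ Subgroup.closure (generators n m T E)) :
    ∃ x ∈ lowSubgroup E (Finset.Ico m n ×ˢ Finset.range m),
      ∃ y ∈ Subgroup.closure (generators m m T E), g = x * y := by
  set V := lowSubgroup E (Finset.Ico m n ×ˢ Finset.range m) with hV
  have hmem : ∀ k l, m ≤ k → k < n → l < m → E k l ∈ V := fun k l h1 h2 h3 =>
    mem_lowSubgroup (by simp [h1, h2, h3])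
  have hTinv : T⁻¹ = T := inv_eq_of_mul_eq_one_left h.T_mul_T
  have hnorm : ∀ s ∈ generators m m T E, ∀ x ∈ V, s * x * s⁻¹ ∈ V ∧ s⁻¹ * x * s⁻¹⁻¹ ∈ V := by
    intro s hs x hx
    suffices ∀ k l, m ≤ k → k < n → l < m → s * E k l * s⁻¹ ∈ V ∧ s⁻¹ * E k l * s⁻¹⁻¹ ∈ V by
      refine ⟨conj_mem_lowSubgroup (fun p hp => (this p.1 p.2 ?_ ?_ ?_).1) hx,
        conj_mem_lowSubgroup (fun p hp => (this p.1 p.2 ?_ ?_ ?_).2) hx⟩ <;>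
      simp only [Finset.mem_product, Finset.mem_Ico, Finset.mem_range] at hp <;> omega
    intro k l hk hk' hl
    have hkl := hmem k l hk hk' hl
    rcases hs with rfl | ⟨i, j, hi, hj, hij, rfl⟩
    · rw [hTinv, hTinv, and_self]
      by_cases hl0 : l = 0
      · subst hl0
        rw [h.T_low_inv k hk hk' hl, mul_assoc, h.T_mul_T, mul_one]
        exact inv_mem hkl
      · rw [(h.T_low_comm k l hk hk' hl hl0).eq, mul_assoc, h.T_mul_T, mul_one]
        exact hkl
    · by_cases hil : i = l
      · subst hil
        have ha := h.act i j k hi hj hk hk' hij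
        have hc := (h.act_comm i j k j hi hj hk hk' hj hij hij).eq
        have hkj := hmem k j hk hk' hj
        constructor
        · rw [ha, mul_inv_cancel_right]
          exact mul_mem (inv_mem hkj) hkl
        · have : (E i j)⁻¹ * E k i * (E i j)⁻¹⁻¹ = E k j * E k i := by
            rw [inv_inv, mul_assoc, inv_mul_eq_iff_eq_mul, ← mul_assoc, hc, mul_assoc, ha,
              ← mul_assoc, mul_inv_cancel_left]
          rw [this]
          exact mul_mem hkj hkl
      · have hc := h.act_comm i j k l hi hj hk hk' hl hij hil
        rw [hc.eq, mul_inv_cancel_right, hc.inv_left.eq, inv_inv, inv_mul_cancel_right, and_self]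
        exact hkl
  have hgen : ∀ s ∈ generators n m T E, s ∈ generators m m T E ∨ s ∈ V := by
    rintro s (rfl | ⟨i, j, hi, hj, hij, rfl⟩)
    · exact Or.inl (Or.inl rfl)
    · by_cases him : i < m
      · exact Or.inl (Or.inr ⟨i, j, him, hj, hij, rfl⟩)
      · exact Or.inr (hmem i j (by omega) hi hj)
  induction hg using Subgroup.closure_induction_left with
  | one => exact ⟨1, one_mem _, 1, one_mem _, by simp⟩
  | mul_left s hs y _ ih =>
    obtain ⟨x, hx, z, hz, rfl⟩ := ih
    rcases hgen s hs with hs' | hs'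
    · exact ⟨s * x * s⁻¹, (hnorm s hs' x hx).1, s * z, mul_mem (Subgroup.subset_closure hs') hz,
        by group⟩
    · exact ⟨s * x, mul_mem hs' hx, z, hz, by group⟩
  | inv_mul_cancel s hs y _ ih =>
    obtain ⟨x, hx, z, hz, rfl⟩ := ih
    rcases hgen s hs with hs' | hs'
    · exact ⟨s⁻¹ * x * s⁻¹⁻¹, (hnorm s hs' x hx).2, s⁻¹ * z,
        mul_mem (inv_mem (Subgroup.subset_closure hs')) hz, by group⟩
    · exact ⟨s⁻¹ * x, mul_mem (inv_mem hs') hx, z, hz, by group⟩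

/-- Faithfulness for `G_m` in `GL_n(ℤ)` follows from faithfulness for `GL_m(ℤ)`, since `G_m` is the
semidirect product of `GL_m(ℤ)` and the abelian group of the blocks `B`. -/
theorem isFaithfulPresentation_of_square (hm : 1 ≤ m) (hmn : m ≤ n)
    (hsq : IsFaithfulPresentation m m) : IsFaithfulPresentation n m := by
  intro P _ T E ρ h hρ g hg h1
  obtain ⟨x, hx, y, hy, rfl⟩ := exists_eq_mul_of_mem_closure h hg
  have hs : ∀ p ∈ Finset.Ico m n ×ˢ Finset.range m, m ≤ p.1 ∧ p.1 < n ∧ p.2 < m := by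
    intro p hp
    simp only [Finset.mem_product, Finset.mem_Ico, Finset.mem_range] at hp
    omega
  have hy1 : ρ y = 1 := by
    refine LinearMap.ext fun v => funext fun k => ?_
    rcases lt_or_ge k m with hk | hk
    · rw [← (apply_of_mem_lowSubgroup hρ hs hx (ρ y v)).1 k hk, ← Module.End.mul_apply, ← map_mul, h1]
    · rw [apply_of_mem_square hm hmn hρ hy v hk, Module.End.one_apply]
  have hy2 : y = 1 := hsq P T E ρ h.square
    ⟨hρ.T, fun i j v hi hj hij => hρ.E i j v (hi.trans_le hmn) hj hij⟩ y hy hy1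
  subst hy2
  rw [mul_one] at h1 ⊢
  exact eq_one_of_mem_lowSubgroup h hρ _ hs x hx h1

theorem isFaithfulPresentation_one : IsFaithfulPresentation 1 1 := by
  intro P _ T E ρ h hρ g hg h1
  have hTinv : T⁻¹ = T := inv_eq_of_mul_eq_one_left h.T_mul_T
  have hg' : g = 1 ∨ g = T := by
    clear h1
    have hgen : ∀ s ∈ generators 1 1 T E, s = T := by
      rintro s (rfl | ⟨i, j, hi, hj, hij, rfl⟩)
      · rfl
      · omega
    induction hg using Subgroup.closure_induction_left with
    | one => exact Or.inl rfl
    | mul_left s hs y _ ih =>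
      rw [hgen s hs]
      rcases ih with rfl | rfl
      · simp
      · exact Or.inl h.T_mul_T
    | inv_mul_cancel s hs y _ ih =>
      rw [hgen s hs, hTinv]
      rcases ih with rfl | rfl
      · simp
      · exact Or.inl h.T_mul_T
  refine hg'.resolve_right fun hT => ?_
  have h2 := congrFun (LinearMap.congr_fun h1 (Pi.single 0 1)) 0
  rw [hT, hρ.T] at h2
  simp at h2

theorem isFaithfulPresentation (hm : 1 ≤ m) (hmn : m ≤ n) : IsFaithfulPresentation n m := by
  induction m, hm using Nat.le_induction generalizing n with
  | base => exact isFaithfulPresentation_of_square le_rfl hmn isFaithfulPresentation_one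
  | succ m hm ih =>
    exact isFaithfulPresentation_of_square (by omega) hmn
      (isFaithfulPresentation_square hm (ih (Nat.le_succ m)))

end Representation
/-! ### Matrices in `G_m` -/

section Matrices

variable {n m : ℕ}

theorem blockMatrix_apply_of_le (hmn : m ≤ n) (A : Matrix (Fin m) (Fin m) ℤ)
    (B : Matrix (Fin (n - m)) (Fin m) ℤ) (i j : Fin n) (hj : m ≤ (j : ℕ)) :
    blockMatrix hmn A B i j = (1 : Matrix (Fin n) (Fin n) ℤ) i j := by
  have h : ∀ k : Fin n, m ≤ (k : ℕ) → ∃ k', k = indexEquiv hmn (Sum.inr k') := fun k hk =>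
    ⟨⟨k - m, by omega⟩, by ext; simp [indexEquiv]; omega⟩
  obtain ⟨j, rfl⟩ := h j hj
  obtain ⟨i, rfl⟩ := (indexEquiv hmn).surjective i
  rw [← blockMatrix_one hmn]
  rcases i with i | i <;>
    simp only [blockMatrix, Matrix.reindex_apply, Matrix.submatrix_apply, Equiv.symm_apply_apply,
      Matrix.fromBlocks_apply₁₂, Matrix.fromBlocks_apply₂₂]

/-- `G_m` consists of the invertible matrices whose columns beyond the first `m` are those of the
identity matrix. -/
theorem mem_blockGroup_iff (hmn : m ≤ n) (g : GL (Fin n) ℤ) :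
    g ∈ blockGroup hmn ↔ ∀ i j : Fin n, m ≤ (j : ℕ) →
      (g : Matrix (Fin n) (Fin n) ℤ) i j = (1 : Matrix (Fin n) (Fin n) ℤ) i j := by
  constructor
  · rintro ⟨A, B, h⟩ i j hj
    rw [h, blockMatrix_apply_of_le hmn _ _ i j hj]
  · intro h
    set M := (g : Matrix (Fin n) (Fin n) ℤ).submatrix (indexEquiv hmn) (indexEquiv hmn) with hM
    have h12 : M.toBlocks₁₂ = 0 := by
      ext i j
      have := h (indexEquiv hmn (Sum.inl i)) (indexEquiv hmn (Sum.inr j)) (by simp [indexEquiv])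
      simpa [hM, Matrix.toBlocks₁₂, Matrix.one_apply] using this
    have h22 : M.toBlocks₂₂ = 1 := by
      ext i j
      have := h (indexEquiv hmn (Sum.inr i)) (indexEquiv hmn (Sum.inr j)) (by simp [indexEquiv])
      simpa [hM, Matrix.toBlocks₂₂, Matrix.one_apply] using this
    have hfb : M = Matrix.fromBlocks M.toBlocks₁₁ 0 M.toBlocks₂₁ 1 := by
      conv_lhs => rw [← Matrix.fromBlocks_toBlocks M]
      rw [h12, h22]
    have hdet : IsUnit M.toBlocks₁₁.det := by
      have h1 : IsUnit M.det := by
        rw [hM, Matrix.det_submatrix_equiv_self]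
        exact (Matrix.isUnit_iff_isUnit_det _).1 g.isUnit
      rwa [hfb, Matrix.det_fromBlocks_zero₁₂, Matrix.det_one, mul_one] at h1
    refine ⟨((Matrix.isUnit_iff_isUnit_det _).2 hdet).unit, M.toBlocks₂₁, ?_⟩
    rw [IsUnit.unit_spec, blockMatrix, ← hfb, hM]
    simp

theorem matE_mulVec (i j : Fin n) (v : Fin n → ℤ) :
    (matE i j).mulVec v = Function.update v i (v i + v j) := by
  ext k
  by_cases hk : k = i
  · subst hk; simp [matE, Matrix.add_mulVec, Matrix.single_mulVec]
  · simp [matE, Matrix.add_mulVec, Matrix.single_mulVec, hk]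

theorem matT_mulVec (i : Fin n) (v : Fin n → ℤ) :
    (matT i).mulVec v = Function.update v i (-v i) := by
  ext k
  by_cases hk : k = i
  · subst hk; simp [matT, Matrix.sub_mulVec, Matrix.single_mulVec]; ring
  · simp [matT, Matrix.sub_mulVec, Matrix.single_mulVec, hk]

theorem eq_of_mulVec {A B : Matrix (Fin n) (Fin n) ℤ} (h : ∀ v, A.mulVec v = B.mulVec v) : A = B :=
  Matrix.ext_of_mulVec_single fun _ => h _

/-- The elementary matrix `E_ij` as an element of `GL_n(ℤ)`. -/
def glE (i j : Fin n) (hij : i ≠ j) : GL (Fin n) ℤ where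
  val := matE i j
  inv := 1 - Matrix.single i j 1
  val_inv := by
    simp [matE, mul_sub, add_mul, Matrix.single_mul_single_of_ne _ _ _ _ hij.symm]
  inv_val := by
    simp [matE, sub_mul, mul_add, Matrix.single_mul_single_of_ne _ _ _ _ hij.symm]

/-- The matrix `T_i` as an element of `GL_n(ℤ)`. -/
def glT (i : Fin n) : GL (Fin n) ℤ where
  val := matT i
  inv := matT i
  val_inv := eq_of_mulVec fun v => by
    simp [← Matrix.mulVec_mulVec, matT_mulVec]
  inv_val := eq_of_mulVec fun v => by
    simp [← Matrix.mulVec_mulVec, matT_mulVec]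

theorem glE_inv_mulVec (i j : Fin n) (hij : i ≠ j) (v : Fin n → ℤ) :
    (((glE i j hij)⁻¹ : GL (Fin n) ℤ) : Matrix (Fin n) (Fin n) ℤ).mulVec v =
      Function.update v i (v i - v j) := by
  change (1 - Matrix.single i j 1 : Matrix (Fin n) (Fin n) ℤ).mulVec v = _
  ext k
  by_cases hk : k = i
  · subst hk; simp [Matrix.sub_mulVec, Matrix.single_mulVec]
  · simp [Matrix.sub_mulVec, Matrix.single_mulVec, hk]

theorem glE_mem_blockGroup (hmn : m ≤ n) {i j : Fin n} (hij : i ≠ j) (hj : (j : ℕ) < m) :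
    glE i j hij ∈ blockGroup hmn := by
  rw [mem_blockGroup_iff]
  intro k l hl
  have : j ≠ l := fun e => by subst e; omega
  simp [glE, matE, this]

theorem glT_mem_blockGroup (hmn : m ≤ n) {i : Fin n} (hi : (i : ℕ) < m) :
    glT i ∈ blockGroup hmn := by
  rw [mem_blockGroup_iff]
  intro k l hl
  have : i ≠ l := fun e => by subst e; omega
  simp [glT, matT, this]

/-- The action of a matrix on sequences of integers, through the first `n` coordinates. -/
def extendEnd (n : ℕ) : Matrix (Fin n) (Fin n) ℤ →* Module.End ℤ (ℕ → ℤ) where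
  toFun A :=
    { toFun := fun v k => if h : k < n then A.mulVec (fun i => v i) ⟨k, h⟩ else v k
      map_add' := fun v w => by
        ext k
        by_cases h : k < n
        · simp only [h, dite_true, Pi.add_apply]
          exact congrFun (A.mulVec_add (fun i => v i) fun i => w i) ⟨k, h⟩
        · simp [h]
      map_smul' := fun a v => by
        ext k
        by_cases h : k < n
        · simp only [h, dite_true, Pi.smul_apply, RingHom.id_apply]
          exact congrFun (A.mulVec_smul a (fun i => v i)) ⟨k, h⟩
        · simp [h] }
  map_one' := by
    refine LinearMap.ext fun v => funext fun k => ?_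
    by_cases h : k < n <;> simp
  map_mul' A B := by
    refine LinearMap.ext fun v => funext fun k => ?_
    by_cases h : k < n
    · simp [h, ← Matrix.mulVec_mulVec]
    · simp [h]

theorem extendEnd_apply (A : Matrix (Fin n) (Fin n) ℤ) (v : ℕ → ℤ) (k : ℕ) :
    extendEnd n A v k = if h : k < n then A.mulVec (fun i => v i) ⟨k, h⟩ else v k := rfl

theorem extendEnd_matE {i j : ℕ} (hi : i < n) (hj : j < n) (v : ℕ → ℤ) :
    extendEnd n (matE ⟨i, hi⟩ ⟨j, hj⟩) v = addRow v i j 1 := by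
  funext k
  rw [extendEnd_apply, addRow, matE_mulVec]
  by_cases hk : k < n
  · by_cases hki : k = i
    · subst hki; simp [hk]
    · simp [hk, hki]
  · simp [hk, show k ≠ i by omega]

theorem extendEnd_matT {i : ℕ} (hi : i < n) (v : ℕ → ℤ) :
    extendEnd n (matT ⟨i, hi⟩) v = Function.update v i (-v i) := by
  funext k
  rw [extendEnd_apply, matT_mulVec]
  by_cases hk : k < n
  · by_cases hki : k = i
    · subst hki; simp [hk]
    · simp [hk, hki]
  · simp [hk, show k ≠ i by omega]

end Matrices

/-! ### Generation of `G_m` by elementary matrices -/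

section Generation

variable {n : ℕ}

theorem glE_zpow_mulVec (i j : Fin n) (hij : i ≠ j) (a : ℤ) (v : Fin n → ℤ) :
    ((glE i j hij ^ a : GL (Fin n) ℤ) : Matrix (Fin n) (Fin n) ℤ).mulVec v =
      Function.update v i (v i + a * v j) := by
  induction a using Int.induction_on generalizing v with
  | zero => simp
  | succ a ih =>
    rw [zpow_add_one, Units.val_mul, ← Matrix.mulVec_mulVec,
      show (glE i j hij : Matrix (Fin n) (Fin n) ℤ) = matE i j from rfl, matE_mulVec, ih]
    simp [hij.symm]; ring_nf
  | pred a ih =>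
    rw [zpow_sub_one, Units.val_mul, ← Matrix.mulVec_mulVec, glE_inv_mulVec, ih]
    simp [hij.symm]; ring_nf

/-- `u` is in the `K`-orbit of `v`. -/
def Reaches (K : Subgroup (GL (Fin n) ℤ)) (v u : Fin n → ℤ) : Prop :=
  ∃ g ∈ K, (g : Matrix (Fin n) (Fin n) ℤ).mulVec v = u

theorem Reaches.trans {K : Subgroup (GL (Fin n) ℤ)} {v u w : Fin n → ℤ} (h : Reaches K v u)
    (h' : Reaches K u w) : Reaches K v w := by
  obtain ⟨g, hg, rfl⟩ := h
  obtain ⟨g', hg', rfl⟩ := h'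
  exact ⟨g' * g, mul_mem hg' hg, by rw [Units.val_mul, ← Matrix.mulVec_mulVec]⟩

theorem Reaches.refl (K : Subgroup (GL (Fin n) ℤ)) (v : Fin n → ℤ) : Reaches K v v :=
  ⟨1, one_mem _, by simp⟩

/-- The entries `v 0, …, v k` have no common divisor except units. -/
def IsPrimitive (k : ℕ) (v : Fin n → ℤ) : Prop :=
  ∀ d : ℤ, (∀ i : Fin n, (i : ℕ) ≤ k → d ∣ v i) → IsUnit d

theorem IsPrimitive.update {k : ℕ} {v : Fin n → ℤ} (hv : IsPrimitive k v) {i j : Fin n}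
    (hij : i ≠ j) (hj : (j : ℕ) ≤ k) (a : ℤ) :
    IsPrimitive k (Function.update v i (v i + a * v j)) := by
  intro d hd
  have hdj : d ∣ v j := by simpa [hij.symm] using hd j hj
  refine hv d fun l hl => ?_
  have := hd l hl
  by_cases hli : l = i
  · subst hli
    rw [Function.update_self] at this
    exact (dvd_add_left (hdj.mul_left a)).1 this
  · rwa [Function.update_of_ne hli] at this

variable {K : Subgroup (GL (Fin n) ℤ)} {k : ℕ}

theorem reaches_update (hE : ∀ (i j : Fin n) (hij : i ≠ j), (j : ℕ) ≤ k → glE i j hij ∈ K)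
    {i j : Fin n} (hij : i ≠ j) (hj : (j : ℕ) ≤ k) (a : ℤ) (v : Fin n → ℤ) :
    Reaches K v (Function.update v i (v i + a * v j)) :=
  ⟨glE i j hij ^ a, zpow_mem (hE i j hij hj) a, glE_zpow_mulVec i j hij a v⟩

/-- The Euclidean algorithm on the entries `v 0, …, v k`. -/
theorem exists_reaches_single_ne_zero
    (hE : ∀ (i j : Fin n) (hij : i ≠ j), (j : ℕ) ≤ k → glE i j hij ∈ K) (v : Fin n → ℤ)
    (hv : IsPrimitive k v) :
    ∃ u, Reaches K v u ∧ IsPrimitive k u ∧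
      ∀ i j : Fin n, (i : ℕ) ≤ k → (j : ℕ) ≤ k → i ≠ j → u i = 0 ∨ u j = 0 := by
  induction hN : ∑ i : Fin n, (v i).natAbs using Nat.strong_induction_on generalizing v with
  | _ N ih =>
    subst hN
    by_cases h : ∀ i j : Fin n, (i : ℕ) ≤ k → (j : ℕ) ≤ k → i ≠ j → v i = 0 ∨ v j = 0
    · exact ⟨v, Reaches.refl K v, hv, h⟩
    push Not at h
    obtain ⟨i, j, hi, hj, hij, hvi, hvj⟩ := h
    wlog hle : (v j).natAbs ≤ (v i).natAbs generalizing i j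
    · exact this j i hj hi hij.symm hvj hvi (by omega)
    have hlt : (v i + -(v i / v j) * v j).natAbs < (v i).natAbs := by
      have e : v i + -(v i / v j) * v j = v i % v j := by
        rw [Int.emod_def]; ring
      rw [e]
      have h1 := Int.emod_nonneg (v i) hvj
      have h2 := Int.emod_lt_abs (v i) hvj
      rw [Int.abs_eq_natAbs] at h2
      omega
    have hsum : ∑ l, (Function.update v i (v i + -(v i / v j) * v j) l).natAbs <
        ∑ l, (v l).natAbs := by
      refine Finset.sum_lt_sum (fun l _ => ?_) ⟨i, Finset.mem_univ _, ?_⟩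
      · by_cases hli : l = i
        · subst hli; rw [Function.update_self]; exact hlt.le
        · rw [Function.update_of_ne hli]
      · rw [Function.update_self]; exact hlt
    obtain ⟨u, hu, hu'⟩ := ih _ hsum _ (hv.update hij hj _) rfl
    exact ⟨u, (reaches_update hE hij hj _ v).trans hu, hu'⟩

theorem exists_reaches_eq_one
    (hE : ∀ (i j : Fin n) (hij : i ≠ j), (j : ℕ) ≤ k → glE i j hij ∈ K)
    (hT : ∀ i : Fin n, (i : ℕ) = 0 → glT i ∈ K) {c : Fin n} (hc : (c : ℕ) = k) (v : Fin n → ℤ)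
    (hv : IsPrimitive k v) : ∃ u, Reaches K v u ∧ u c = 1 := by
  obtain ⟨u, hu, hprim, h0⟩ := exists_reaches_single_ne_zero hE v hv
  obtain ⟨i, hi, hui⟩ : ∃ i : Fin n, (i : ℕ) ≤ k ∧ u i ≠ 0 := by
    by_contra! hall
    exact not_isUnit_zero (hprim 0 fun i hi => by rw [hall i hi])
  have hunit : IsUnit (u i) := hprim _ fun j hj => by
    by_cases hij : i = j
    · rw [hij]
    · rw [(h0 i j hi hj hij).resolve_left hui]; exact dvd_zero _
  by_cases hic : c = i
  · subst hic
    rcases Int.isUnit_iff.1 hunit with h1 | h1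
    · exact ⟨u, hu, h1⟩
    by_cases hk : k = 0
    · refine ⟨_, hu.trans ⟨glT c, hT c (hc.trans hk), matT_mulVec c u⟩, ?_⟩
      simp [h1]
    · have h0n : 0 < n := c.pos
      have hne : (⟨0, h0n⟩ : Fin n) ≠ c := fun e => hk (by rw [← hc, ← e])
      have hz : u ⟨0, h0n⟩ = 0 := (h0 c ⟨0, h0n⟩ hi (Nat.zero_le _) hne.symm).resolve_left hui
      refine ⟨_, (hu.trans (reaches_update hE hne hi 1 u)).trans
        (reaches_update hE hne.symm (Nat.zero_le _) (-2) _), ?_⟩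
      simp [hne.symm, hz, h1]
  · refine ⟨_, hu.trans (reaches_update hE hic hi (u i) u), ?_⟩
    rw [Function.update_self, (h0 c i hc.le hi hic).resolve_right hui, zero_add]
    rcases Int.isUnit_iff.1 hunit with h1 | h1 <;> simp [h1]

theorem reaches_single (hE : ∀ (i j : Fin n) (hij : i ≠ j), (j : ℕ) ≤ k → glE i j hij ∈ K)
    {c : Fin n} (hc : (c : ℕ) = k) (u : Fin n → ℤ) (hu : u c = 1) :
    Reaches K u (Pi.single c 1) := by
  have key : ∀ s : Finset (Fin n), c ∉ s → Reaches K u (fun i => if i ∈ s then 0 else u i) := by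
    intro s
    induction s using Finset.induction_on with
    | empty => intro _; simpa using Reaches.refl K u
    | insert i s his ih =>
      intro hcs
      rw [Finset.mem_insert, not_or] at hcs
      convert (ih hcs.2).trans (reaches_update hE (Ne.symm hcs.1) hc.le (-u i) _) using 1
      funext l
      by_cases hli : l = i
      · subst hli; simp [his, hcs.2, hu]
      · simp [hli]
  convert key (Finset.univ.erase c) (by simp) using 1
  funext l
  by_cases hl : l = c
  · subst hl; simp [hu]
  · simp [hl]

/-- A subgroup that contains `T_1` and the `E_ij` with `j ≤ m` contains `G_m`: the columns of a matrix
are turned into basis vectors one after the other, from the last of the first `m` to the first. -/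
theorem blockGroup_le {m : ℕ} {S : Subgroup (GL (Fin n) ℤ)}
    (hE : ∀ (i j : Fin n) (hij : i ≠ j), (j : ℕ) < m → glE i j hij ∈ S)
    (hT : ∀ i : Fin n, (i : ℕ) = 0 → glT i ∈ S) (hmn : m ≤ n) : blockGroup hmn ≤ S := by
  suffices ∀ k ≤ m, ∀ hk : k ≤ n, blockGroup hk ≤ S from this m le_rfl hmn
  intro k
  induction k with
  | zero =>
    intro _ hk g hg
    have : g = 1 := Units.ext (Matrix.ext fun i j => (mem_blockGroup_iff hk g).1 hg i j (Nat.zero_le _))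
    rw [this]
    exact one_mem _
  | succ k ih =>
    intro hkm hk g hg
    set c : Fin n := ⟨k, hk⟩ with hc
    set v : Fin n → ℤ := fun i => (g : Matrix (Fin n) (Fin n) ℤ) i c with hv
    have hprim : IsPrimitive k v := by
      intro d hd
      have h1 : ∑ j, ((g⁻¹ : GL (Fin n) ℤ) : Matrix (Fin n) (Fin n) ℤ) c j * v j = 1 := by
        have : ((g⁻¹ : GL (Fin n) ℤ) : Matrix (Fin n) (Fin n) ℤ) * g = 1 := Units.inv_mul g
        rw [← Matrix.one_apply_eq (α := ℤ) c, ← this, Matrix.mul_apply]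
      rw [isUnit_iff_dvd_one, ← h1]
      refine Finset.dvd_sum fun j _ => ?_
      rcases le_or_gt (j : ℕ) k with hj | hj
      · exact (hd j hj).mul_left _
      · rw [(mem_blockGroup_iff hk _).1 (inv_mem hg) c j hj,
          Matrix.one_apply_ne (fun e => by rw [← e] at hj; exact lt_irrefl _ hj), zero_mul]
        exact dvd_zero _
    have hE' : ∀ (i j : Fin n) (hij : i ≠ j), (j : ℕ) ≤ k → glE i j hij ∈ S ⊓ blockGroup hk :=
      fun i j hij hj => ⟨hE i j hij (by omega), glE_mem_blockGroup hk hij (by omega)⟩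
    have hT' : ∀ i : Fin n, (i : ℕ) = 0 → glT i ∈ S ⊓ blockGroup hk :=
      fun i hi => ⟨hT i hi, glT_mem_blockGroup hk (by omega)⟩
    obtain ⟨u, hu, huc⟩ := exists_reaches_eq_one hE' hT' (c := c) rfl v hprim
    obtain ⟨x, ⟨hxS, hxB⟩, hx⟩ := hu.trans (reaches_single hE' (c := c) rfl u huc)
    have hxg : x * g ∈ blockGroup (Nat.le_of_succ_le hk) := by
      rw [mem_blockGroup_iff]
      intro i j hj
      by_cases hjc : j = c
      · subst hjc
        rw [Units.val_mul, Matrix.mul_apply]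
        have := congrFun hx i
        rw [Matrix.mulVec, dotProduct] at this
        rw [this, Pi.single_apply, Matrix.one_apply]
      · refine (mem_blockGroup_iff hk _).1 (mul_mem hxB hg) i j ?_
        have : (j : ℕ) ≠ k := fun e => hjc (Fin.ext e)
        omega
    have := S.mul_mem (S.inv_mem hxS) (ih (by omega) _ hxg)
    rwa [inv_mul_cancel_left] at this

end Generation
/-! ### Finiteness of the presentation -/

section Finiteness

variable {n m : ℕ}

theorem finite_gen (n m : ℕ) : Finite (Gen n m) := by
  let f : Gen n m → Option (Fin n × Fin n) := fun
    | .T => none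
    | .E i j _ _ => some (i, j)
  refine Finite.of_injective f ?_
  rintro (_ | ⟨i, j, _, _⟩) (_ | ⟨k, l, _, _⟩) h <;> simp_all [f]

/-- The generator `E_ij` of the free group, or `1` if the indices are out of range. -/
def totalE (m : ℕ) (i j : Fin n) : FreeGroup (Gen n m) :=
  if h : (j : ℕ) < m ∧ i ≠ j then wE i j h.1 h.2 else 1

theorem totalE_eq {i j : Fin n} (hj : (j : ℕ) < m) (hij : i ≠ j) : totalE m i j = wE i j hj hij :=
  dif_pos ⟨hj, hij⟩

theorem finite_relators (n m : ℕ) : (relators n m).Finite := by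
  have hfin : (insert (wT n m ^ 2) (⋃ p : Fin n × Fin n × Fin n × Fin n,
      let a := totalE m p.1 p.2.1
      let b := totalE m p.2.1 p.1
      let c := totalE m p.2.2.1 p.2.2.2
      let d := totalE m p.2.1 p.2.2.1
      let e := totalE m p.1 p.2.2.1
      let f := totalE m p.2.2.1 p.1
      let g := totalE m p.2.2.1 p.2.1
      let t := wT n m
      {(a * b⁻¹ * a) ^ 4, a * b⁻¹ * a * b * a⁻¹ * b, ⁅a, c⁆, ⁅a, d⁆ * e⁻¹, ⁅t, a⁆, t * a * t * a,
        a * c * a⁻¹ * c⁻¹, a * f * a⁻¹ * (g⁻¹ * f)⁻¹, t * a * t * a⁻¹,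
        t * a * t * a⁻¹⁻¹})).Finite :=
    (Set.finite_iUnion fun p => Set.toFinite _).insert _
  refine hfin.subset ?_
  have mem : ∀ {r : FreeGroup (Gen n m)} {S : Fin n × Fin n × Fin n × Fin n → Set (FreeGroup (Gen n m))}
      (i j k l : Fin n), r ∈ S (i, j, k, l) → r ∈ insert (wT n m ^ 2) (⋃ p, S p) :=
    fun i j k l h => Or.inr (Set.mem_iUnion.2 ⟨(i, j, k, l), h⟩)
  rintro r ((hr | hr) | hr)
  · rcases hr with ⟨i, j, k, l, hi, hj, hk, hl, hij, hkl⟩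
    exact mem i j k l (by simp [totalE_eq, *])
  · rcases hr with _ | ⟨p, q, hp0, hq1, hp, hq, hpq, hqp⟩ | ⟨p, q, hp0, hq1, hp, hq, hpq, hqp⟩ |
      ⟨i, j, k, l, hi, hj, hk, hl, hij, hkl, hil, hjk⟩ | ⟨i, j, k, hi, hj, hk, hij, hjk, hik⟩ |
      ⟨i, j, hi, hj, hij, hi0, hj0⟩ | ⟨i, j, hi, hj, hij, h0⟩
    · exact Or.inl rfl
    · exact mem p q p q (by simp only [totalE_eq hq hpq, totalE_eq hp hqp]; simp)
    · exact mem p q p q (by simp only [totalE_eq hq hpq, totalE_eq hp hqp]; simp)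
    · exact mem i j k l (by simp only [totalE_eq hj hij, totalE_eq hl hkl]; simp)
    · exact mem i j k k (by simp only [totalE_eq hj hij, totalE_eq hk hjk, totalE_eq hk hik]; simp)
    · exact mem i j i j (by simp only [totalE_eq hj hij]; simp)
    · exact mem i j i j (by simp only [totalE_eq hj hij]; simp)
  · rcases hr with ⟨i, j, k, l, hi, hj, hk, hl, hij, hkl, hil⟩ | ⟨i, j, k, hi, hj, hk, hij, hki, hkj⟩ |
      ⟨k, l, hk, hl, hkl, hk0, hl0⟩ | ⟨k, l, hk, hl, hkl, h0⟩
    · exact mem i j k l (by simp only [totalE_eq hj hij, totalE_eq hl hkl]; simp)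
    · exact mem i j k k (by simp only [totalE_eq hj hij, totalE_eq hi hki, totalE_eq hj hkj]; simp)
    · exact mem k l k l (by simp only [totalE_eq hl hkl]; simp)
    · exact mem k l k l (by simp only [totalE_eq hl hkl]; simp)

end Finiteness

/-! ### The relators hold in `G_m` -/

section Hom

variable {n m : ℕ} (hm : 1 ≤ m) (hmn : m ≤ n)

/-- The assignment of the matrices in `G_m` to the symbols of the same names. -/
def genMatrix : Gen n m → blockGroup hmn
  | .T => ⟨glT ⟨0, lt_of_lt_of_le hm hmn⟩, glT_mem_blockGroup hmn hm⟩
  | .E i j hj hij => ⟨glE i j hij, glE_mem_blockGroup hmn hij hj⟩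

theorem gl_ext {g h : GL (Fin n) ℤ} (H : ∀ v, (g : Matrix (Fin n) (Fin n) ℤ).mulVec v =
    (h : Matrix (Fin n) (Fin n) ℤ).mulVec v) : g = h :=
  Units.ext (eq_of_mulVec H)

theorem glE_mulVec (i j : Fin n) (hij : i ≠ j) (v : Fin n → ℤ) :
    ((glE i j hij : GL (Fin n) ℤ) : Matrix (Fin n) (Fin n) ℤ).mulVec v =
      Function.update v i (v i + v j) := matE_mulVec i j v

theorem glT_mulVec (i : Fin n) (v : Fin n → ℤ) :
    ((glT i : GL (Fin n) ℤ) : Matrix (Fin n) (Fin n) ℤ).mulVec v =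
      Function.update v i (-v i) := matT_mulVec i v

theorem glT_mul_self (i : Fin n) : glT i * glT i = 1 := gl_ext fun v => by
  simp [← Matrix.mulVec_mulVec, glT_mulVec]

theorem glE_commute {i j k l : Fin n} (hij : i ≠ j) (hkl : k ≠ l) (hil : i ≠ l) (hjk : j ≠ k) :
    Commute (glE i j hij) (glE k l hkl) := gl_ext fun v => by
  simp only [Units.val_mul, ← Matrix.mulVec_mulVec, glE_mulVec]
  funext x
  simp only [Function.update_apply]
  grind

theorem glE_mul {i j k : Fin n} (hij : i ≠ j) (hjk : j ≠ k) (hik : i ≠ k) :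
    glE i j hij * glE j k hjk = glE i k hik * glE j k hjk * glE i j hij := gl_ext fun v => by
  simp only [Units.val_mul, ← Matrix.mulVec_mulVec, glE_mulVec]
  funext x
  simp only [Function.update_apply]
  grind

theorem glT_mul_glE_mul {t i j : Fin n} (hij : i ≠ j) (h : i = t ∨ j = t) :
    glT t * glE i j hij * glT t = (glE i j hij)⁻¹ := gl_ext fun v => by
  simp only [Units.val_mul, ← Matrix.mulVec_mulVec, glE_mulVec, glT_mulVec, glE_inv_mulVec]
  funext x
  simp only [Function.update_apply]
  grind

theorem glT_commute {t i j : Fin n} (hij : i ≠ j) (hi : i ≠ t) (hj : j ≠ t) :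
    Commute (glT t) (glE i j hij) := gl_ext fun v => by
  simp only [Units.val_mul, ← Matrix.mulVec_mulVec, glE_mulVec, glT_mulVec]
  funext x
  simp only [Function.update_apply]
  grind

/-- `weyl` of elementary matrices, evaluated on vectors. -/
theorem glE_weyl_mulVec {i j : Fin n} (hij : i ≠ j) (hji : j ≠ i) (v : Fin n → ℤ) :
    ((glE i j hij * (glE j i hji)⁻¹ * glE i j hij : GL (Fin n) ℤ) :
      Matrix (Fin n) (Fin n) ℤ).mulVec v =
      Function.update (Function.update v i (v j)) j (-v i) := by
  simp only [Units.val_mul, ← Matrix.mulVec_mulVec, glE_mulVec, glE_inv_mulVec]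
  funext x
  simp only [Function.update_apply]
  grind

theorem glE_weyl_pow_four {i j : Fin n} (hij : i ≠ j) (hji : j ≠ i) :
    (glE i j hij * (glE j i hji)⁻¹ * glE i j hij) ^ 4 = 1 := gl_ext fun v => by
  rw [pow_succ, pow_succ, pow_succ, pow_one]
  generalize hw : glE i j hij * (glE j i hji)⁻¹ * glE i j hij = w
  have h : ∀ v, (w : Matrix (Fin n) (Fin n) ℤ).mulVec v =
      Function.update (Function.update v i (v j)) j (-v i) := hw ▸ glE_weyl_mulVec hij hji
  simp only [Units.val_mul, ← Matrix.mulVec_mulVec, h, Units.val_one, Matrix.one_mulVec]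
  funext x
  simp only [Function.update_apply]
  grind

theorem glE_weyl_mul {i j : Fin n} (hij : i ≠ j) (hji : j ≠ i) :
    glE i j hij * (glE j i hji)⁻¹ * glE i j hij *
      (glE j i hji * (glE i j hij)⁻¹ * glE j i hji) = 1 := gl_ext fun v => by
  rw [Units.val_mul, ← Matrix.mulVec_mulVec, glE_weyl_mulVec, glE_weyl_mulVec]
  simp only [Units.val_one, Matrix.one_mulVec]
  funext x
  simp only [Function.update_apply]
  grind

theorem lift_relator {r : FreeGroup (Gen n m)} (hr : r ∈ relators n m) :
    FreeGroup.lift (genMatrix hm hmn) r = 1 := by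
  apply Subtype.ext
  set ψ : FreeGroup (Gen n m) →* GL (Fin n) ℤ :=
    (blockGroup hmn).subtype.comp (FreeGroup.lift (genMatrix hm hmn)) with hψ
  have hE : ∀ (i j : Fin n) (hj : (j : ℕ) < m) (hij : i ≠ j), ψ (wE i j hj hij) = glE i j hij :=
    fun i j hj hij => by
      rw [hψ, MonoidHom.comp_apply, wE, FreeGroup.lift_apply_of]; rfl
  have hT : ψ (wT n m) = glT ⟨0, lt_of_lt_of_le hm hmn⟩ := by
    rw [hψ, MonoidHom.comp_apply, wT, FreeGroup.lift_apply_of]; rfl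
  have hT2 := glT_mul_self (⟨0, lt_of_lt_of_le hm hmn⟩ : Fin n)
  have hcomm : ∀ {x y : GL (Fin n) ℤ}, Commute x y → x * y * x⁻¹ * y⁻¹ = 1 := fun h => by
    rw [h.eq]; group
  have hz : ∀ {i : Fin n}, (i : ℕ) = 0 → i = ⟨0, lt_of_lt_of_le hm hmn⟩ := fun h => Fin.ext h
  have hz' : ∀ {i : Fin n}, (i : ℕ) ≠ 0 → i ≠ ⟨0, lt_of_lt_of_le hm hmn⟩ :=
    fun h e => h (Fin.ext_iff.1 e)
  have hTc : ∀ {i j : Fin n} (hij : i ≠ j), (i : ℕ) ≠ 0 → (j : ℕ) ≠ 0 →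
      Commute (glT ⟨0, lt_of_lt_of_le hm hmn⟩) (glE i j hij) :=
    fun hij hi hj => glT_commute hij (hz' hi) (hz' hj)
  show ψ r = 1
  rcases hr with (hr | hr) | hr
  · rcases hr with ⟨i, j, k, l, hi, hj, hk, hl, hij, hkl⟩
    simp only [commutatorElement_def, map_mul, map_inv, hE]
    exact hcomm (glE_commute hij hkl (fun e => by subst e; omega) (fun e => by subst e; omega))
  · rcases hr with _ | ⟨p, q, hp0, hq1, hp, hq, hpq, hqp⟩ | ⟨p, q, hp0, hq1, hp, hq, hpq, hqp⟩ |
      ⟨i, j, k, l, hi, hj, hk, hl, hij, hkl, hil, hjk⟩ | ⟨i, j, k, hi, hj, hk, hij, hjk, hik⟩ |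
      ⟨i, j, hi, hj, hij, hi0, hj0⟩ | ⟨i, j, hi, hj, hij, h0⟩ <;>
      simp only [commutatorElement_def, map_mul, map_inv, map_pow, hE, hT]
    · rw [pow_two, hT2]
    · exact glE_weyl_pow_four hpq hqp
    · simpa only [mul_assoc] using glE_weyl_mul hpq hqp
    · exact hcomm (glE_commute hij hkl hil hjk)
    · rw [glE_mul hij hjk hik]; group
    · exact hcomm (hTc hij hi0 hj0)
    · rw [glT_mul_glE_mul hij (h0.imp hz hz), inv_mul_cancel]
  · rcases hr with ⟨i, j, k, l, hi, hj, hk, hl, hij, hkl, hil⟩ | ⟨i, j, k, hi, hj, hk, hij, hki, hkj⟩ |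
      ⟨k, l, hk, hl, hkl, hk0, hl0⟩ | ⟨k, l, hk, hl, hkl, h0⟩ <;>
      simp only [map_mul, map_inv, hE, hT]
    · exact hcomm (glE_commute hij hkl hil (fun e => by subst e; omega))
    · have h1 := glE_mul hki hij hkj
      have h3 : glE i j hij * glE k i hki = (glE k j hkj)⁻¹ * glE k i hki * glE i j hij := by
        rw [mul_assoc, h1, mul_assoc, inv_mul_cancel_left]
      rw [h3]; group
    · rw [(hTc hkl hk0 hl0).eq, mul_assoc (glE k l hkl), hT2]; group
    · rw [glT_mul_glE_mul hkl (h0.imp hz hz), inv_inv, inv_mul_cancel]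

end Hom

/-! ### The isomorphism -/

section Presented

variable {n m : ℕ}

/-- The class of `E_ij` in the presented group, for indices in `ℕ`, or `1` if they are out of range. -/
noncomputable def presentedE (n m : ℕ) (i j : ℕ) : PresentedGroup (relators n m) :=
  if h : (i < n ∧ j < n) ∧ j < m ∧ i ≠ j then
    PresentedGroup.mk _ (wE ⟨i, h.1.1⟩ ⟨j, h.1.2⟩ h.2.1 (fun e => h.2.2 (Fin.ext_iff.1 e))) else 1

theorem presentedE_eq (hmn : m ≤ n) {i j : ℕ} (hi : i < n) (hj : j < m) (hij : i ≠ j) :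
    presentedE n m i j = PresentedGroup.mk (relators n m)
      (wE ⟨i, hi⟩ ⟨j, hj.trans_le hmn⟩ hj (fun e => hij (Fin.ext_iff.1 e))) :=
  dif_pos ⟨⟨hi, hj.trans_le hmn⟩, hj, hij⟩

theorem mk_relator {r : FreeGroup (Gen n m)} (hr : r ∈ relators n m) :
    PresentedGroup.mk (relators n m) r = 1 :=
  (QuotientGroup.eq_one_iff _).2 (Subgroup.subset_normalClosure hr)

theorem commute_of_commutator {P : Type} [Group P] {x y : P} (h : x * y * x⁻¹ * y⁻¹ = 1) :
    Commute x y := by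
  rwa [mul_inv_eq_one, mul_inv_eq_iff_eq_mul] at h

theorem blockRel_presented (hm : 1 ≤ m) (hmn : m ≤ n) :
    BlockRel n m (PresentedGroup.mk (relators n m) (wT n m)) (presentedE n m) := by
  have h1 : ∀ {r}, R₁ n m r → PresentedGroup.mk (relators n m) r = 1 :=
    fun h => mk_relator (Or.inl (Or.inl h))
  have h2 : ∀ {r}, R₂ n m r → PresentedGroup.mk (relators n m) r = 1 :=
    fun h => mk_relator (Or.inl (Or.inr h))
  have h3 : ∀ {r}, R₃ n m r → PresentedGroup.mk (relators n m) r = 1 :=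
    fun h => mk_relator (Or.inr h)
  have hT : PresentedGroup.mk (relators n m) (wT n m) * PresentedGroup.mk (relators n m) (wT n m)
      = 1 := by
    have := h2 R₂.T_sq
    rwa [map_pow, pow_two] at this
  have hT' := inv_eq_of_mul_eq_one_left hT
  have ne : ∀ {i j : ℕ} (hi : i < n) (hj : j < n), i ≠ j → (⟨i, hi⟩ : Fin n) ≠ ⟨j, hj⟩ :=
    fun _ _ h e => h (Fin.ext_iff.1 e)
  refine ⟨hT, ?_, ?_, ?_, ?_, ?_, ?_, ?_, ?_, ?_, ?_, ?_⟩
  · intro i j k l hi hj hk hl hij hkl hil hjk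
    have := h2 (R₂.comm ⟨i, by omega⟩ ⟨j, by omega⟩ ⟨k, by omega⟩ ⟨l, by omega⟩ hi hj hk hl
      (ne _ _ hij) (ne _ _ hkl) (ne _ _ hil) (ne _ _ hjk))
    rw [presentedE_eq hmn (by omega) hj hij, presentedE_eq hmn (by omega) hl hkl]
    simp only [commutatorElement_def, map_mul, map_inv] at this
    exact commute_of_commutator this
  · intro i j k hi hj hk hij hjk hik
    have := h2 (R₂.steinberg ⟨i, by omega⟩ ⟨j, by omega⟩ ⟨k, by omega⟩ hi hj hk
      (ne _ _ hij) (ne _ _ hjk) (ne _ _ hik))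
    rw [presentedE_eq hmn (by omega) hj hij, presentedE_eq hmn (by omega) hk hjk,
      presentedE_eq hmn (by omega) hk hik]
    simp only [commutatorElement_def, map_mul, map_inv] at this
    rwa [mul_inv_eq_one, mul_inv_eq_iff_eq_mul, mul_inv_eq_iff_eq_mul] at this
  · intro hm2
    have := h2 (R₂.braid ⟨0, by omega⟩ ⟨1, by omega⟩ rfl rfl (show 0 < m by omega)
      (show 1 < m by omega) (ne _ _ zero_ne_one) (ne _ _ one_ne_zero))
    rw [weyl, weyl, presentedE_eq hmn (by omega) (by omega) zero_ne_one,
      presentedE_eq hmn (by omega) (by omega) one_ne_zero]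
    simp only [map_mul, map_inv] at this
    simpa only [mul_assoc] using this
  · intro hm2
    have := h2 (R₂.four ⟨0, by omega⟩ ⟨1, by omega⟩ rfl rfl (show 0 < m by omega)
      (show 1 < m by omega) (ne _ _ zero_ne_one) (ne _ _ one_ne_zero))
    rw [weyl, presentedE_eq hmn (by omega) (by omega) zero_ne_one,
      presentedE_eq hmn (by omega) (by omega) one_ne_zero]
    simpa only [map_mul, map_inv, map_pow] using this
  · intro i j hi hj hij hi0 hj0
    have := h2 (R₂.T_comm ⟨i, by omega⟩ ⟨j, by omega⟩ hi hj (ne _ _ hij) hi0 hj0)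
    rw [presentedE_eq hmn (by omega) hj hij]
    simp only [commutatorElement_def, map_mul, map_inv] at this
    exact commute_of_commutator this
  · intro i j hi hj hij h0
    have := h2 (R₂.T_inv ⟨i, by omega⟩ ⟨j, by omega⟩ hi hj (ne _ _ hij) h0)
    rw [presentedE_eq hmn (by omega) hj hij]
    simp only [map_mul] at this
    rwa [mul_eq_one_iff_eq_inv, ← eq_mul_inv_iff_mul_eq, hT'] at this
  · intro i j k l hi hi' hj hk hk' hl
    have := h1 (R₁.comm ⟨i, hi'⟩ ⟨j, by omega⟩ ⟨k, hk'⟩ ⟨l, by omega⟩ hi hj hk hl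
      (ne _ _ (by omega)) (ne _ _ (by omega)))
    rw [presentedE_eq hmn (by omega) hj (by omega), presentedE_eq hmn (by omega) hl (by omega)]
    simp only [commutatorElement_def, map_mul, map_inv] at this
    exact commute_of_commutator this
  · intro i j k l hi hj hk hk' hl hij hil
    have := h3 (R₃.E_comm ⟨i, by omega⟩ ⟨j, by omega⟩ ⟨k, hk'⟩ ⟨l, by omega⟩ hi hj hk hl
      (ne _ _ hij) (ne _ _ (by omega)) (ne _ _ hil))
    rw [presentedE_eq hmn (by omega) hj (by omega), presentedE_eq hmn (by omega) hl (by omega)]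
    simp only [map_mul, map_inv] at this
    exact commute_of_commutator this
  · intro i j k hi hj hk hk' hij
    have := h3 (R₃.E_act ⟨i, by omega⟩ ⟨j, by omega⟩ ⟨k, hk'⟩ hi hj hk
      (ne _ _ hij) (ne _ _ (by omega)) (ne _ _ (by omega)))
    rw [presentedE_eq hmn (by omega) hj hij, presentedE_eq hmn hk' hi (by omega),
      presentedE_eq hmn hk' hj (by omega)]
    simp only [map_mul, map_inv] at this
    rwa [mul_inv_eq_one, mul_inv_eq_iff_eq_mul] at this
  · intro k l hk hk' hl hl0
    have := h3 (R₃.T_comm ⟨k, hk'⟩ ⟨l, by omega⟩ hk hl (ne _ _ (by omega))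
      (show k ≠ 0 by omega) hl0)
    rw [presentedE_eq hmn hk' hl (by omega)]
    simp only [map_mul, map_inv] at this
    rwa [mul_inv_eq_one, ← eq_mul_inv_iff_mul_eq, hT'] at this
  · intro k hk hk' h0
    have := h3 (R₃.T_inv ⟨k, hk'⟩ ⟨0, by omega⟩ hk h0 (ne _ _ (by omega)) (Or.inr rfl))
    rw [presentedE_eq hmn hk' h0 (by omega)]
    simp only [map_mul, map_inv] at this
    rwa [mul_inv_eq_one, ← eq_mul_inv_iff_mul_eq, hT'] at this

theorem mem_closure_generators (hmn : m ≤ n) (g : PresentedGroup (relators n m)) :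
    g ∈ Subgroup.closure
      (generators n m (PresentedGroup.mk (relators n m) (wT n m)) (presentedE n m)) := by
  refine PresentedGroup.generated_by _ _ (fun x => ?_) g
  rcases x with _ | ⟨i, j, hj, hij⟩
  · exact T_mem
  · have hij' : (i : ℕ) ≠ j := fun e => hij (Fin.ext e)
    have := E_mem (T := PresentedGroup.mk (relators n m) (wT n m)) (E := presentedE n m) i.2 hj hij'
    rwa [presentedE_eq hmn i.2 hj hij'] at this

/-- The homomorphism from the presented group to `G_m` induced by `genMatrix`. -/
noncomputable def presentedHom (hm : 1 ≤ m) (hmn : m ≤ n) :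
    PresentedGroup (relators n m) →* blockGroup hmn :=
  PresentedGroup.toGroup (f := genMatrix hm hmn) fun _ => lift_relator hm hmn

theorem presentedHom_T (hm : 1 ≤ m) (hmn : m ≤ n) :
    ((presentedHom hm hmn (PresentedGroup.of Gen.T) : blockGroup hmn) : GL (Fin n) ℤ) =
      glT ⟨0, lt_of_lt_of_le hm hmn⟩ := by
  rw [presentedHom, PresentedGroup.toGroup.of]; rfl

theorem presentedHom_E (hm : 1 ≤ m) (hmn : m ≤ n) (i j : Fin n) (hj : (j : ℕ) < m) (hij : i ≠ j) :
    ((presentedHom hm hmn (PresentedGroup.of (Gen.E i j hj hij)) : blockGroup hmn) :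
      GL (Fin n) ℤ) = glE i j hij := by
  rw [presentedHom, PresentedGroup.toGroup.of]; rfl

theorem presentedHom_injective (hm : 1 ≤ m) (hmn : m ≤ n) :
    Function.Injective (presentedHom hm hmn) := by
  rw [injective_iff_map_eq_one]
  intro g hg
  set ρ : PresentedGroup (relators n m) →* Module.End ℤ (ℕ → ℤ) :=
    (extendEnd n).comp ((Units.coeHom _).comp
      ((blockGroup hmn).subtype.comp (presentedHom hm hmn))) with hρ
  refine isFaithfulPresentation hm hmn _ _ _ ρ (blockRel_presented hm hmn) ⟨fun v => ?_,
    fun i j v hi hj hij => ?_⟩ g (mem_closure_generators hmn g) ?_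
  · have : ρ (PresentedGroup.mk (relators n m) (wT n m)) =
        extendEnd n (glT (n := n) ⟨0, lt_of_lt_of_le hm hmn⟩ : GL (Fin n) ℤ) :=
      congrArg (fun g : GL (Fin n) ℤ => extendEnd n g) (presentedHom_T hm hmn)
    rw [this]
    exact extendEnd_matT _ v
  · rw [presentedE_eq hmn hi hj hij]
    have := congrArg (fun g : GL (Fin n) ℤ => extendEnd n g)
      (presentedHom_E hm hmn ⟨i, hi⟩ ⟨j, hj.trans_le hmn⟩ hj (fun e => hij (Fin.ext_iff.1 e)))
    exact (LinearMap.congr_fun this v).trans (extendEnd_matE hi (hj.trans_le hmn) v)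
  · simp [hρ, hg]

theorem presentedHom_surjective (hm : 1 ≤ m) (hmn : m ≤ n) :
    Function.Surjective (presentedHom hm hmn) := by
  have hle : blockGroup hmn ≤ (presentedHom hm hmn).range.map (blockGroup hmn).subtype := by
    refine blockGroup_le (m := m) (fun i j hij hj => ?_) (fun i hi => ?_) hmn
    · exact ⟨presentedHom hm hmn (.of (Gen.E i j hj hij)), ⟨_, rfl⟩, presentedHom_E hm hmn i j hj hij⟩
    · refine ⟨presentedHom hm hmn (.of Gen.T), ⟨_, rfl⟩, (presentedHom_T hm hmn).trans ?_⟩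
      rw [show i = ⟨0, lt_of_lt_of_le hm hmn⟩ from Fin.ext hi]
  intro x
  obtain ⟨_, ⟨g, rfl⟩, hg⟩ := hle x.2
  exact ⟨g, Subtype.ext hg⟩

end Presented
end BlockTriangular

theorem proposition4p2 (n m : ℕ) (hm : 1 ≤ m) (hmn : m ≤ n) :
    Finite (BlockTriangular.Gen n m) ∧ (BlockTriangular.relators n m).Finite ∧
    ∃ φ : PresentedGroup (BlockTriangular.relators n m) ≃* BlockTriangular.blockGroup hmn,
      (((φ (PresentedGroup.of BlockTriangular.Gen.T) : BlockTriangular.blockGroup hmn) :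
          GL (Fin n) ℤ) : Matrix (Fin n) (Fin n) ℤ) =
        BlockTriangular.matT ⟨0, lt_of_lt_of_le hm hmn⟩ ∧
      ∀ (i j : Fin n) (hj : (j : ℕ) < m) (hij : i ≠ j),
        (((φ (PresentedGroup.of (BlockTriangular.Gen.E i j hj hij)) :
            BlockTriangular.blockGroup hmn) : GL (Fin n) ℤ) : Matrix (Fin n) (Fin n) ℤ) =
          BlockTriangular.matE i j := by
  refine ⟨BlockTriangular.finite_gen n m, BlockTriangular.finite_relators n m,
    MulEquiv.ofBijective (BlockTriangular.presentedHom hm hmn)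
      ⟨BlockTriangular.presentedHom_injective hm hmn,
        BlockTriangular.presentedHom_surjective hm hmn⟩, ?_, fun i j hj hij => ?_⟩
  · exact congrArg Units.val (BlockTriangular.presentedHom_T hm hmn)
  · exact congrArg Units.val (BlockTriangular.presentedHom_E hm hmn i j hj hij)
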